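/- Let $n\ge 2$ and $\mathbb T^n=\mathbb R^n/\mathbb Z^n$ with its flat metric. For $x=(x_1,\dots,x_n)$ write $\tilde x=(x_1,\dots,x_{n-1})$. A map is transitive if some point has a dense forward orbit, and a map of class $C^2$ is $C^2$ robustly transitive if it has a neighbourhood in the $C^2$ topology all of whose members are transitive. **The map $f$.** Let $A(x)=(8x_1,2x_2,\dots,2x_n)$ on $\mathbb T^n$ and $p=(\tfrac14,0,\dots,0,\tfrac14)$, $\tilde p=(\tfrac14,0,\dots,0)\in\mathbb R^{n-1}$. Let $B(q,r)$ denote open balls of $\mathbb T^n$. Fix real numbers $r,\theta,a,\delta$ and functions $\psi,\varphi:\mathbb R\to\mathbb R$ of class $C^\infty$ such that: * $r>0$; $A(B(p,r))\cap\overline{B(p,r)}=\emptyset$; $A^{-1}(B(p,r))\cap\{x_n=0\}=\emptyset$; $B(p,r)\cap B(Ap,r)=B(Ap,r)\cap B(0,r)=\emptyset$; * $0<\theta<r/2$; $\psi=0$ outside $I=(\tfrac1{16}-\theta,\tfrac1{16}+\theta)$; the only critical point of $\psi$ in $I$ is $\tfrac1{16}$; $\psi(\tfrac1{16})=4$, $\psi''(\tfrac1{16})=0$;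 and $\psi(\tfrac1{16}+s)=\psi(\tfrac1{16}-s)$ for all $s$; * $0<a<\tfrac37$, $0<\delta<2\theta$ and $2Mr\delta(1+a)<a$, where $M=\max|\psi'|$; * $\varphi=0$ outside $J=[\tfrac14-\tfrac\delta4,\tfrac14+\tfrac{3\delta}4]$ and $-\tfrac34\le\varphi'\le1$ on $J$; $\varphi(\tfrac14)=0$, $\varphi'(\tfrac14)=\tfrac12$, $\varphi''(\tfrac14)\ne0$, $\varphi'(\tfrac14+\tfrac\delta8)=1$; and $\tfrac14+\tfrac\delta8$ is the only point at which $\varphi''=0$ and $\varphi'>0$. Taking coordinates in $[-\tfrac12,\tfrac12)$ inside $\varphi$ and $\psi$, define $f:\mathbb T^n\to\mathbb T^n$ by $$f(x)=\Bigl(8x_1,2x_2,\dots,2x_{n-1},\,2x_n-\varphi(x_n)\,\psi\bigl(\textstyle\sum_{k<n}x_k^2\bigr)\Bigr).$$ Let $S_f=\{x:\det D_xf=0\}$. **The flattening map $F$.** Let $\varepsilon>0$. Let $U\ni\tilde p$ and $V\ni\frac14$ be open in $\mathbb R^{n-1}$ and $\mathbb R$, and let $\phi:U\to V$ be a $C^\infty$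 function with $\phi(\tilde p)=\tfrac14$ such that a point $(\tilde x,x_n)\in U\times V$ lies in $S_f$ if and only if $x_n=\phi(\tilde x)$. For $z\in\mathbb R^{n-1}$ put $\tau(z)=\tilde p+(\tfrac{z_1}8,\tfrac{z_2}2,\dots,\tfrac{z_{n-1}}2)$ and, where $\tau(z)\in U$, $$\Phi(z)=2\phi(\tau(z))-\varphi\bigl(\phi(\tau(z))\bigr)\,\psi\bigl(\|\tau(z)\|^2\bigr).$$ Let $0<\varepsilon'<\varepsilon/50$ and let $W\subset\tau^{-1}(U)$ be an open neighbourhood of $0$ on which, for all $k,k'$, the quantities $|\Phi-\tfrac12|$, $|\partial_k\Phi|$, $|\partial_k\partial_{k'}\Phi|$ are smaller than $\varepsilon'$, and $|\Phi(z)-\tfrac12|\le\varepsilon'\|z\|^2$, $|\partial_k\Phi(z)|\le\varepsilon'\|z\|$. Let $0<l<b<\tfrac14$ with $\{\|z\|\le2b\}\subset W$, and let $\omega:\mathbb R\to\mathbb R$ be $C^\infty$ with $\omega=1$ on $(-l,l)$, $\omega=0$ outside $(-2l,2l)$, $|\omega|\le1$, $|\omega'|<2/l$ and $|\omega''|<8/l^2$.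 Put $u(z)=\omega(\|z\|)\,(\Phi(z)-\tfrac12)+\tfrac12$ (so $u=\tfrac12$ for $\|z\|\ge2l$), and, with $\tilde x$ taken in $[-\tfrac12,\tfrac12)^{n-1}$ inside $u$, $$F(x)=\bigl(\tilde x,\;x_n-u(\tilde x)+\tfrac12\bigr),\qquad F:\mathbb T^n\to\mathbb T^n .$$ **Theorem.** For every $f$ as above there is $\varepsilon_0>0$ such that for every $\varepsilon\in(0,\varepsilon_0)$ and every $F$ constructed as above with this $\varepsilon$, the map $H=F\circ f$ is $C^2$ robustly transitive. -/

import Mathlib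

open scoped ContDiff

noncomputable section

namespace TorusEndo

/-- Euclidean space `ℝⁿ`. -/
abbrev Vec (n : ℕ) : Type := EuclideanSpace ℝ (Fin n)

/-- The torus `𝕋ⁿ = ℝⁿ / ℤⁿ`. -/
abbrev Torus (n : ℕ) : Type := UnitAddTorus (Fin n)

/-- The covering projection `ℝⁿ → 𝕋ⁿ`. -/
def toTorus {n : ℕ} (x : Vec n) : Torus n := fun i => ((x i : ℝ) : UnitAddCircle)

/-- The representative in `[-1/2, 1/2)` of a point of `ℝ / ℤ`. -/
def rep (c : UnitAddCircle) : ℝ := (AddCircle.equivIco (1 : ℝ) (-1 / 2) c : ℝ)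

/-- The open ball of the flat (Euclidean) distance of the torus. -/
def torusBall {n : ℕ} (c : Torus n) (r : ℝ) : Set (Torus n) :=
  {t | ∃ x y : Vec n, toTorus x = c ∧ toTorus y = t ∧ dist x y < r}

/-! ### Transitivity and the `C^k` topology -/

/-- Some point has a dense forward orbit. -/
def IsTransitive {X : Type*} [TopologicalSpace X] (g : X → X) : Prop :=
  ∃ x : X, Dense (Set.range fun k : ℕ => g^[k] x)

/-- `G : ℝⁿ → ℝⁿ` is a lift of the torus map `g`. -/
def IsLift {n : ℕ} (G : Vec n → Vec n) (g : Torus n → Torus n) : Prop :=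
  ∀ x, toTorus (G x) = g (toTorus x)

/-- `g` is a `C^k` endomorphism of the torus: it has a lift of class `C^k`. -/
def IsCk {n : ℕ} (k : ℕ) (g : Torus n → Torus n) : Prop :=
  ∃ G : Vec n → Vec n, IsLift G g ∧ ContDiff ℝ k G

/-- The `ε`-neighbourhood of `f` in the `C^k` topology: the `C^k` maps `g` for which suitable
`C^k` lifts of `g` and `f` differ by less than `ε`, together with their derivatives up to
order `k`. -/
def ckNhd {n : ℕ} (k : ℕ) (f : Torus n → Torus n) (ε : ℝ) : Set (Torus n → Torus n) :=
  {g | ∃ G F : Vec n → Vec n, IsLift G g ∧ IsLift F f ∧ ContDiff ℝ k G ∧ ContDiff ℝ k F ∧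
    ∀ i ≤ k, ∀ x, ‖iteratedFDeriv ℝ i (fun y => G y - F y) x‖ < ε}

/-- `f` is a `C^k` endomorphism with a `C^k` neighbourhood in which every map is transitive. -/
def IsRobustlyTransitive {n : ℕ} (k : ℕ) (f : Torus n → Torus n) : Prop :=
  IsCk k f ∧ ∃ ε : ℝ, 0 < ε ∧ ∀ g ∈ ckNhd k f ε, IsTransitive g

/-- The critical set of a torus map: the points where the differential is singular. -/
def criticalSet {n : ℕ} (g : Torus n → Torus n) : Set (Torus n) :=
  {t | ∃ (G : Vec n → Vec n) (x : Vec n), IsLift G g ∧ ContDiff ℝ 1 G ∧ toTorus x = t ∧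
    (fderiv ℝ G x).det = 0}

/-! ### The map `f`

The dimension of the torus is `n = d + 2`.  The coordinates `x₁` and `xₙ` have the indices `0`
and `Fin.last (d + 1)`, and `(x₁, …, xₙ₋₁)` is indexed by `Fin (d + 1)`. -/

/-- The linear endomorphism `A (x₁, …, xₙ) = (8 x₁, 2 x₂, …, 2 xₙ)`. -/
def linearA (d : ℕ) (t : Torus (d + 2)) : Torus (d + 2) :=
  fun i => if i = 0 then (8 : ℕ) • t i else (2 : ℕ) • t i

/-- The first `n - 1` coordinates of `p`, that is `(1/4, 0, …, 0)`. -/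
def centerInit (d : ℕ) : Vec (d + 1) := EuclideanSpace.single 0 (1 / 4)

/-- The point of `ℝⁿ` with first `n - 1` coordinates `z` and last coordinate `s`. -/
def snocVec {d : ℕ} (z : Vec (d + 1)) (s : ℝ) : Vec (d + 2) :=
  WithLp.toLp 2 (Fin.snoc (α := fun _ => ℝ) (fun k => z k) s)

/-- The point `p = (1/4, 0, …, 0, 1/4)` of the torus. -/
def center (d : ℕ) : Torus (d + 2) := toTorus (snocVec (centerInit d) (1 / 4))

/-- The conditions on the radius `r`. -/
structure IsAdmissibleRadius (d : ℕ) (r : ℝ) : Prop where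
  pos : 0 < r
  image_disjoint :
    linearA d '' torusBall (center d) r ∩ closure (torusBall (center d) r) = ∅
  preimage_disjoint :
    linearA d ⁻¹' torusBall (center d) r ∩ {t | t (Fin.last (d + 1)) = 0} = ∅
  ball_disjoint : torusBall (center d) r ∩ torusBall (linearA d (center d)) r = ∅
  ball_zero_disjoint : torusBall (linearA d (center d)) r ∩ torusBall 0 r = ∅

/-- The conditions on `ψ`; away from `(1/16 - θ, 1/16 + θ)` the function vanishes, and `1/16` is
its only critical point in that interval. -/
structure IsPsi (θ : ℝ) (ψ : ℝ → ℝ) : Prop where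
  smooth : ContDiff ℝ ∞ ψ
  crit_iff : ∀ x ∈ Set.Ioo (1 / 16 - θ) (1 / 16 + θ), deriv ψ x = 0 ↔ x = 1 / 16
  value : ψ (1 / 16) = 4
  deriv_two : iteratedDeriv 2 ψ (1 / 16) = 0
  eq_zero : ∀ x ∉ Set.Ioo (1 / 16 - θ) (1 / 16 + θ), ψ x = 0
  symmetric : ∀ x, ψ (1 / 16 + x) = ψ (1 / 16 - x)

/-- The conditions on `φ`.  The field `unimodal` records the shape of the graph of `φ'`: its
only critical point at a positive height is the maximum, at `1/4 + δ/8`. -/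
structure IsPhi (δ : ℝ) (φ : ℝ → ℝ) : Prop where
  smooth : ContDiff ℝ ∞ φ
  value : φ (1 / 4) = 0
  deriv_one : deriv φ (1 / 4) = 1 / 2
  deriv_two : iteratedDeriv 2 φ (1 / 4) ≠ 0
  deriv_max : deriv φ (1 / 4 + δ / 8) = 1
  eq_zero : ∀ x ∉ Set.Icc (1 / 4 - δ / 4) (1 / 4 + 3 * δ / 4), φ x = 0
  deriv_mem : ∀ x ∈ Set.Icc (1 / 4 - δ / 4) (1 / 4 + 3 * δ / 4),
    -(3 / 4) ≤ deriv φ x ∧ deriv φ x ≤ 1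
  unimodal : ∀ x, iteratedDeriv 2 φ x = 0 → 0 < deriv φ x → x = 1 / 4 + δ / 8

/-- The map `f (x₁, …, xₙ) = (8 x₁, 2 x₂, …, 2 xₙ - φ(xₙ) ψ(x₁² + ⋯ + xₙ₋₁²))` of the torus,
with coordinates taken in `[-1/2, 1/2)` inside `φ` and `ψ`. -/
def mapF (d : ℕ) (φ ψ : ℝ → ℝ) (t : Torus (d + 2)) : Torus (d + 2) :=
  linearA d t - Pi.single (Fin.last (d + 1))
    ((φ (rep (t (Fin.last (d + 1)))) * ψ (∑ k : Fin (d + 1), rep (t k.castSucc) ^ 2) : ℝ) :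
      UnitAddCircle)

/-! ### The flattening diffeomorphism -/

/-- The partial derivative of `g` in the `k`-th coordinate. -/
def partialD {m : ℕ} (k : Fin m) (g : Vec m → ℝ) (z : Vec m) : ℝ :=
  fderiv ℝ g z (EuclideanSpace.single k 1)

/-- The local inverse branch near `0` of `(x₁, …, xₙ₋₁) ↦ (8 x₁, 2 x₂, …, 2 xₙ₋₁)` on the torus
whose value at `0` is `(1/4, 0, …, 0)`. -/
def invBranch (d : ℕ) (z : Vec (d + 1)) : Vec (d + 1) :=
  WithLp.toLp 2 fun k => centerInit d k + (if k = 0 then z k / 8 else z k / 2)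

/-- `χ : U → V` is the implicit function that describes, near `p`, the critical set of `f` as
the graph `xₙ = χ(x₁, …, xₙ₋₁)`. -/
structure IsImplicitFunction (d : ℕ) (φ ψ : ℝ → ℝ) (U : Set (Vec (d + 1))) (V : Set ℝ)
    (χ : Vec (d + 1) → ℝ) : Prop where
  isOpen_U : IsOpen U
  mem_U : centerInit d ∈ U
  isOpen_V : IsOpen V
  mem_V : (1 / 4 : ℝ) ∈ V
  mapsTo : Set.MapsTo χ U V
  smooth : ContDiffOn ℝ ∞ χ U
  value : χ (centerInit d) = 1 / 4
  graph : ∀ z ∈ U, ∀ s ∈ V, toTorus (snocVec z s) ∈ criticalSet (mapF d φ ψ) ↔ s = χ z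

/-- The function `Φ` whose graph is the image under `f` of the graph of `χ`. -/
def imageGraph (d : ℕ) (φ ψ : ℝ → ℝ) (χ : Vec (d + 1) → ℝ) (z : Vec (d + 1)) : ℝ :=
  2 * χ (invBranch d z) - φ (χ (invBranch d z)) * ψ (∑ k, invBranch d z k ^ 2)

/-- On `W` the function `Φ` is `ε'`-close to `1/2` in the `C²` sense, with quadratic and linear
bounds at the origin. -/
structure IsFlatOn {m : ℕ} (Φ : Vec m → ℝ) (ε' : ℝ) (W : Set (Vec m)) : Prop where
  isOpen : IsOpen W
  zero_mem : (0 : Vec m) ∈ W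
  abs_lt : ∀ z ∈ W, |Φ z - 1 / 2| < ε'
  partial_lt : ∀ z ∈ W, ∀ k, |partialD k Φ z| < ε'
  partial_two_lt : ∀ z ∈ W, ∀ k k', |partialD k (partialD k' Φ) z| < ε'
  abs_le : ∀ z ∈ W, |Φ z - 1 / 2| ≤ ε' * ‖z‖ ^ 2
  partial_le : ∀ z ∈ W, ∀ k, |partialD k Φ z| ≤ ε' * ‖z‖

/-- The conditions on the cut-off function `η`. -/
structure IsCutoff (l : ℝ) (η : ℝ → ℝ) : Prop where
  smooth : ContDiff ℝ ∞ η
  eq_one : ∀ s, |s| < l → η s = 1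
  eq_zero : ∀ s, 2 * l ≤ |s| → η s = 0
  abs_le : ∀ s, |η s| ≤ 1
  deriv_lt : ∀ s, |deriv η s| < 2 / l
  deriv_two_lt : ∀ s, |iteratedDeriv 2 η s| < 8 / l ^ 2

/-- The function `u(z) = η(‖z‖) (Φ(z) - 1/2) + 1/2`. -/
def cutGraph {m : ℕ} (η : ℝ → ℝ) (Φ : Vec m → ℝ) (z : Vec m) : ℝ :=
  η ‖z‖ * (Φ z - 1 / 2) + 1 / 2

/-- The torus map `(x₁, …, xₙ) ↦ (x₁, …, xₙ₋₁, xₙ - u(x₁, …, xₙ₋₁) + 1/2)`, with coordinates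
taken in `[-1/2, 1/2)` inside `u`. -/
def shear (d : ℕ) (u : Vec (d + 1) → ℝ) (t : Torus (d + 2)) : Torus (d + 2) :=
  t + Pi.single (Fin.last (d + 1))
    ((1 / 2 - u (WithLp.toLp 2 fun k => rep (t k.castSucc)) : ℝ) : UnitAddCircle)

/-- `F` is a flattening diffeomorphism of size `ε` for the map `f` given by `φ` and `ψ`. -/
def IsFlattening (d : ℕ) (φ ψ : ℝ → ℝ) (ε : ℝ) (F : Torus (d + 2) → Torus (d + 2)) : Prop :=
  ∃ (U : Set (Vec (d + 1))) (V : Set ℝ) (χ : Vec (d + 1) → ℝ) (ε' : ℝ) (W : Set (Vec (d + 1)))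
    (b l : ℝ) (η : ℝ → ℝ),
    IsImplicitFunction d φ ψ U V χ ∧
    0 < ε' ∧ ε' < ε / 50 ∧
    Set.MapsTo (invBranch d) W U ∧
    IsFlatOn (imageGraph d φ ψ χ) ε' W ∧
    0 < b ∧ b < 1 / 4 ∧ Metric.closedBall (0 : Vec (d + 1)) (2 * b) ⊆ W ∧
    0 < l ∧ l < b ∧
    IsCutoff l η ∧
    F = shear d (cutGraph η (imageGraph d φ ψ χ))

end TorusEndo

end

open TorusEndo

noncomputable section

namespace TorusEndo

open Set Filter Topology MeasureTheory

/-! The composite lifts to `x ↦ stretch x - Q x • eₙ` with `Q` periodic (`isLift_shearedProfile`).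
Here `Q` is `φ(xₙ) ψ(‖x̃‖²)`, periodized, plus a C¹-small function of the first `n - 1` coordinates
contributed by the flattening. Three features survive C²-small perturbations and give transitivity.

Hyperbolicity: a cone field around the first axis is invariant, and the first coordinate grows by a
factor at least 7 inside it (`IsModel.exists_cone`). A blender: where `x₁` is within `1/10` of a
half-integer the profile vanishes, so the map is close to the expanding linear map. Preorbits of
every point of the torus therefore accumulate at each point whose orbit never leaves these slabs
(`IsExpandingLift.exists_preorbit`). Nondegeneracy: the Jacobian determinant has nonzero
differential on the critical set. By a Sard argument, almost every line parallel to the first axis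
then contains only countably many critical points of each iterate (`ae_countable_iterate_critical`).

Let `U` be open. A suitable segment in `U` parallel to the first axis is stretched by `G^[k]` until
its first coordinate crosses a whole slab. Each 0-1 sequence prescribes a route through the slabs,
and distinct routes need distinct points of the segment. These points are uncountably many, so one
of them is regular for `G^[k]` (`exists_itinerary_notMem`). Near it `G^[k]` is open, so `G^[k]` maps
`U` onto a neighbourhood of a point that stays in the slabs, and the forward orbit of `U` covers the
torus (`IsExpandingLift.exists_iterate_eq`). Baire's theorem then yields a dense orbit. -/

/-! ### Lines tangent to a hypersurface: a Sard argument. -/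

/-- The union of the lines parallel to the `t`-th axis through the points of `T`. -/
def lineSaturation {n : ℕ} (t : Fin n) (T : Set (Vec n)) : Set (Vec n) :=
  {x | ∃ z ∈ T, ∃ s : ℝ, x = z + s • EuclideanSpace.single t (1 : ℝ)}

/-- The coordinate derivatives determine a linear functional. -/
lemma exists_apply_single_ne_zero {n : ℕ} {L : Vec n →L[ℝ] ℝ} (hL : L ≠ 0) :
    ∃ i, L (EuclideanSpace.single i (1 : ℝ)) ≠ 0 := by
  by_contra! h
  apply hL
  ext v
  have hv : v = ∑ i, v i • EuclideanSpace.single i (1 : ℝ) := by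
    ext j
    simp [Finset.sum_apply, Pi.single_apply]
  rw [hv]
  simp [h]

lemma det_eq_zero_of_apply_eq_zero {n : ℕ} {L : Vec n →L[ℝ] Vec n} {v : Vec n} (hv : v ≠ 0)
    (h : L v = 0) : L.det = 0 := by
  by_contra hd
  apply hv
  have := L.coe_toContinuousLinearEquivOfDetNeZero hd
  apply (L.toContinuousLinearEquivOfDetNeZero hd).injective
  rw [map_zero, ContinuousLinearMap.toContinuousLinearEquivOfDetNeZero_apply, h]

lemma single_one_ne_zero {n : ℕ} (t : Fin n) : EuclideanSpace.single t (1 : ℝ) ≠ 0 := by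
  simp

/-- Local form of `volume_lineSaturation_eq_zero`. -/
lemma exists_nhds_volume_lineSaturation {n : ℕ} (t : Fin n) {h : Vec n → ℝ} {z : Vec n}
    (hh : ContDiffAt ℝ 1 h z) (hne : fderiv ℝ h z ≠ 0)
    (hz : fderiv ℝ h z (EuclideanSpace.single t 1) = 0) :
    ∃ N ∈ 𝓝 z, volume (lineSaturation t
      {x ∈ N | h x = 0 ∧ fderiv ℝ h x (EuclideanSpace.single t 1) = 0}) = 0 := by
  obtain ⟨i, hi⟩ := exists_apply_single_ne_zero hne
  have hit : i ≠ t := by rintro rfl; exact hi hz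
  set e : Fin n → Vec n := fun j => EuclideanSpace.single j (1 : ℝ) with he
  set pr : Fin n → Vec n →L[ℝ] ℝ := fun j => EuclideanSpace.proj j with hpr
  -- `Q` replaces the coordinate `x i` by `h x`; since `∂ᵢh(z) ≠ 0` it is a local diffeomorphism at
  -- `z`, with inverse `R`.
  set Q : Vec n → Vec n := fun x => x + (h x - x i) • e i with hQ
  have hQd : ∀ x, DifferentiableAt ℝ h x → HasFDerivAt Q
      (ContinuousLinearMap.id ℝ _ + (fderiv ℝ h x - pr i).smulRight (e i)) x := by
    intro x hx
    exact (hasFDerivAt_id x).add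
      ((hx.hasFDerivAt.sub (pr i).hasFDerivAt).smul_const (e i))
  have hQc : ContDiffAt ℝ 1 Q z := by
    exact contDiffAt_id.add ((hh.sub (pr i).contDiff.contDiffAt).smul
      (contDiffAt_const (c := e i)))
  set Q' := ContinuousLinearMap.id ℝ (Vec n) + (fderiv ℝ h z - pr i).smulRight (e i) with hQ'
  have hinj : Function.Injective (Q' : Vec n →ₗ[ℝ] Vec n) := by
    rw [← LinearMap.ker_eq_bot, LinearMap.ker_eq_bot']
    intro v hv0
    have h1 : v + (fderiv ℝ h z v - v i) • e i = 0 := by simpa [hQ', hpr] using hv0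
    have h2 : fderiv ℝ h z v = 0 := by simpa [he] using congrArg (fun w : Vec n => w i) h1
    have h3 : v = v i • e i := by
      rw [h2, zero_sub, neg_smul, ← sub_eq_add_neg, sub_eq_zero] at h1; exact h1
    rw [h3, map_smul, smul_eq_mul, mul_eq_zero, or_iff_left hi] at h2
    rw [h3, h2, zero_smul]
  set Qe : Vec n ≃L[ℝ] Vec n :=
    (LinearEquiv.ofInjectiveEndo (Q' : Vec n →ₗ[ℝ] Vec n) hinj).toContinuousLinearEquiv with hQe
  have hQe' : (Qe : Vec n →L[ℝ] Vec n) = Q' := by ext v; rfl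
  have hQz : HasFDerivAt Q (Qe : Vec n →L[ℝ] Vec n) z := by
    rw [hQe']; exact hQd z (hh.differentiableAt one_ne_zero)
  set R := hQc.localInverse hQz one_ne_zero with hR
  have hRc : ContDiffAt ℝ 1 R (Q z) := hQc.to_localInverse hQz one_ne_zero
  have hRQ : ∀ᶠ x in 𝓝 z, R (Q x) = x :=
    (hQc.hasStrictFDerivAt' hQz one_ne_zero).eventually_left_inverse
  have hN : ∀ᶠ x in 𝓝 z, (∀ᶠ y in 𝓝 x, R (Q y) = y) ∧ ContDiffAt ℝ 1 h x ∧
      ContDiffAt ℝ 1 R (Q x) :=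
    hRQ.eventually_nhds.and ((hh.eventually (by simp)).and
      (hQc.continuousAt.eventually (hRc.eventually (by simp))))
  refine ⟨_, hN, ?_⟩
  set T := {x ∈ {x | (∀ᶠ y in 𝓝 x, R (Q y) = y) ∧ ContDiffAt ℝ 1 h x ∧ ContDiffAt ℝ 1 R (Q x)} |
    h x = 0 ∧ fderiv ℝ h x (EuclideanSpace.single t 1) = 0} with hT
  -- On `h = 0` the `i`-th coordinate of `Q x` is 0, so that slot is free to carry the position
  -- along the line: `f` applies `R` to the other coordinates and puts `w i` in the `t`-th
  -- coordinate. Thus `f` parametrizes the saturation in dimension `n`.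
  set f : Vec n → Vec n := fun w => R (w - w i • e i) + (w i - R (w - w i • e i) t) • e t with hf
  set P : Vec n →L[ℝ] Vec n := ContinuousLinearMap.id ℝ _ - (pr i).smulRight (e i) with hP
  set D : Vec n → Vec n →L[ℝ] Vec n := fun w => (fderiv ℝ R (P w)).comp P with hD
  set f' : Vec n → Vec n →L[ℝ] Vec n := fun w =>
    D w + (pr i - (pr t).comp (D w)).smulRight (e t) with hf'
  have hQi : ∀ x ∈ T, ∀ c : ℝ, P (Q x + c • e i) = Q x ∧ (Q x + c • e i) i = c := by
    intro x hx c
    have : (Q x) i = 0 := by simp [hQ, he, hx.2.1]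
    constructor
    · simp [hP, hpr, this]
      simp [he]
    · simp [this, he]
  have himage : lineSaturation t T ⊆ f '' {w | ∃ x ∈ T, ∃ c : ℝ, w = Q x + c • e i} := by
    rintro _ ⟨x, hx, s, rfl⟩
    refine ⟨Q x + (x t + s) • e i, ⟨x, hx, _, rfl⟩, ?_⟩
    obtain ⟨h1, h2⟩ := hQi x hx (x t + s)
    have h3 : f (Q x + (x t + s) • e i) = R (Q x) + ((x t + s) - R (Q x) t) • e t := by
      have : (Q x + (x t + s) • e i) - (Q x + (x t + s) • e i) i • e i = Q x := h1
      simp only [hf]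
      rw [this, h2]
    rw [h3, hx.1.1.self_of_nhds, add_sub_cancel_left]
  refine measure_mono_null himage ?_
  refine addHaar_image_eq_zero_of_det_fderivWithin_eq_zero (f' := f') volume ?_ ?_
  · rintro w ⟨x, hx, c, rfl⟩
    apply HasFDerivAt.hasFDerivWithinAt
    obtain ⟨h1, h2⟩ := hQi x hx c
    have hR1 : HasFDerivAt (fun w => R (P w)) (D (Q x + c • e i)) (Q x + c • e i) := by
      apply HasFDerivAt.comp _ _ P.hasFDerivAt
      apply DifferentiableAt.hasFDerivAt
      rw [h1]; exact hx.1.2.2.differentiableAt one_ne_zero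
    exact hR1.add (((pr i).hasFDerivAt.sub ((pr t).hasFDerivAt.comp _ hR1)).smul_const (e t))
  · rintro w ⟨x, hx, c, rfl⟩
    obtain ⟨h1, h2⟩ := hQi x hx c
    -- Tangency `∂ₜh = 0` makes `DQ`, hence `DR`, fix `eₜ`; then `f` overwrites the `t`-th
    -- coordinate, so `Df` kills `eₜ`.
    refine det_eq_zero_of_apply_eq_zero (single_one_ne_zero t) ?_
    have hRx := (hx.1.2.2.differentiableAt one_ne_zero).hasFDerivAt
    have hQx := hQd x (hx.1.2.1.differentiableAt one_ne_zero)
    have h3 := ((hRx.comp x hQx).congr_of_eventuallyEq (f₁ := id)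
      (hx.1.1.mono fun y hy => hy.symm)).unique (hasFDerivAt_id x)
    have h4 : fderiv ℝ R (Q x) (e t) = e t := by
      have := congrArg (fun L : Vec n →L[ℝ] Vec n => L (e t)) h3
      simpa [hpr, he, hx.2.2, hit, hit.symm] using this
    have h5 : P (e t) = e t := by simp [hP, hpr, he, hit]
    have h6 : D (Q x + c • e i) (e t) = e t := by
      simp only [hD, ContinuousLinearMap.comp_apply, h1, h5, h4]
    change f' _ (e t) = 0
    simp only [hf', _root_.add_apply, h6, ContinuousLinearMap.smulRight_apply,
      _root_.sub_apply, ContinuousLinearMap.comp_apply]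
    simp [hpr, he, hit]

/-- A form of Sard's theorem: the lines parallel to an axis that are tangent to a nondegenerate
`C¹` hypersurface fill a null set. -/
lemma volume_lineSaturation_eq_zero {n : ℕ} (t : Fin n) {O : Set (Vec n)} {h : Vec n → ℝ}
    (hh : ∀ x ∈ O, ContDiffAt ℝ 1 h x) (hne : ∀ x ∈ O, h x = 0 → fderiv ℝ h x ≠ 0) :
    volume (lineSaturation t
      {x ∈ O | h x = 0 ∧ fderiv ℝ h x (EuclideanSpace.single t 1) = 0}) = 0 := by
  set T := {x ∈ O | h x = 0 ∧ fderiv ℝ h x (EuclideanSpace.single t 1) = 0} with hT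
  choose! N hN hN0 using fun (z : Vec n) (hz : z ∈ T) =>
    exists_nhds_volume_lineSaturation t (hh z hz.1) (hne z hz.1 hz.2.1) hz.2.2
  obtain ⟨S, hS, hSc, hcov⟩ := TopologicalSpace.countable_cover_nhdsWithin
    fun z hz => mem_nhdsWithin_of_mem_nhds (hN z hz)
  refine measure_mono_null (t := ⋃ z ∈ S, lineSaturation t
      {x ∈ N z | h x = 0 ∧ fderiv ℝ h x (EuclideanSpace.single t 1) = 0}) ?_ ?_
  · rintro x ⟨y, hy, s, rfl⟩
    obtain ⟨z, hz, hyz⟩ := mem_iUnion₂.1 (hcov hy)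
    exact mem_iUnion₂.2 ⟨z, hz, y, ⟨hyz, hy.2⟩, s, rfl⟩
  · exact (measure_biUnion_null_iff hSc).2 fun z hz => hN0 z (hS hz)

/-- Lindelöf: countably many neighbourhoods, each meeting `C` in at most one point, cover `C`. -/
lemma countable_of_forall_isolated {C : Set ℝ}
    (hC : ∀ s ∈ C, ∀ᶠ u in 𝓝[≠] s, u ∉ C) : C.Countable := by
  obtain ⟨S, hS, hSc, hcov⟩ := TopologicalSpace.countable_cover_nhdsWithin
    (f := fun s => {u | u ∈ C → u = s}) (s := C) fun s hs => by
      apply mem_nhdsWithin_of_mem_nhds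
      filter_upwards [eventually_nhdsWithin_iff.1 (hC s hs)] with u hu huC
      by_contra hne
      exact hu hne huC
  refine hSc.mono fun u hu => ?_
  obtain ⟨s, hs, hus⟩ := mem_iUnion₂.1 (hcov hu)
  rw [hus hu]; exact hs

/-- Almost every line parallel to an axis meets a nondegenerate `C¹` hypersurface in a countable
set. -/
lemma ae_countable_line_inter {n : ℕ} (t : Fin n) {O : Set (Vec n)} {h : Vec n → ℝ}
    (hh : ∀ x ∈ O, ContDiffAt ℝ 1 h x) (hne : ∀ x ∈ O, h x = 0 → fderiv ℝ h x ≠ 0) :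
    ∀ᵐ x : Vec n, {s : ℝ | x + s • EuclideanSpace.single t (1 : ℝ) ∈ O ∧
      h (x + s • EuclideanSpace.single t (1 : ℝ)) = 0}.Countable := by
  have h0 := volume_lineSaturation_eq_zero t hh hne
  filter_upwards [measure_eq_zero_iff_ae_notMem.1 h0] with x hx
  refine countable_of_forall_isolated fun s hs => ?_
  set z := x + s • EuclideanSpace.single t (1 : ℝ) with hz
  -- Off the null set of tangent lines, every zero of `h` along the line is simple, hence isolated.
  have hd : fderiv ℝ h z (EuclideanSpace.single t 1) ≠ 0 := by
    intro h1
    exact hx ⟨z, ⟨hs.1, hs.2, h1⟩, -s, by rw [hz]; simp⟩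
  have h2 : HasDerivAt (fun u : ℝ => h (x + u • EuclideanSpace.single t (1 : ℝ)))
      (fderiv ℝ h z (EuclideanSpace.single t 1)) s := by
    have h3 : HasDerivAt (fun u : ℝ => x + u • EuclideanSpace.single t (1 : ℝ))
        (EuclideanSpace.single t (1 : ℝ)) s := by
      simpa using ((hasDerivAt_id s).smul_const (EuclideanSpace.single t (1 : ℝ))).const_add x
    exact ((hh z hs.1).differentiableAt one_ne_zero).hasFDerivAt.comp_hasDerivAt s h3
  filter_upwards [h2.eventually_ne hd (c := 0)] with u hu hu2
  exact hu hu2.2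


/-! ### Critical points of iterates. -/

lemma contDiff_iterate {n : ℕ} {G : Vec n → Vec n} (hG : ContDiff ℝ 2 G) (j : ℕ) :
    ContDiff ℝ 2 (G^[j]) := by
  induction j with
  | zero => exact contDiff_id
  | succ j ih => rw [Function.iterate_succ']; exact hG.comp ih

lemma hasFDerivAt_iterate {n : ℕ} {G : Vec n → Vec n} (hG : ContDiff ℝ 2 G) (j : ℕ) (x : Vec n) :
    HasFDerivAt (G^[j + 1]) ((fderiv ℝ G (G^[j] x)).comp (fderiv ℝ (G^[j]) x)) x := by
  rw [Function.iterate_succ']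
  exact ((hG.differentiable two_ne_zero) _).hasFDerivAt.comp x
    (((contDiff_iterate hG j).differentiable two_ne_zero) x).hasFDerivAt

/-- If the critical set of a `C²` map is nondegenerate, then almost every line parallel to an axis
contains only countably many critical points of each iterate. -/
lemma ae_countable_iterate_critical {n : ℕ} (t : Fin n) {G : Vec n → Vec n}
    (hG : ContDiff ℝ 2 G) (hD : ContDiff ℝ 1 fun x => (fderiv ℝ G x).det)
    (hne : ∀ x, (fderiv ℝ G x).det = 0 → fderiv ℝ (fun y => (fderiv ℝ G y).det) x ≠ 0) (j : ℕ) :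
    ∀ᵐ x : Vec n, {s : ℝ |
      (fderiv ℝ (G^[j]) (x + s • EuclideanSpace.single t (1 : ℝ))).det = 0}.Countable := by
  induction j with
  | zero =>
    refine Eventually.of_forall fun x => ?_
    simp [ContinuousLinearMap.det]
  | succ j ih =>
    have hGj : ContDiff ℝ 2 (G^[j]) := contDiff_iterate hG j
    have hh : ContDiff ℝ 1 fun x => (fderiv ℝ G (G^[j] x)).det :=
      hD.comp (hGj.of_le one_le_two)
    -- By the chain rule a critical point of `G^[j + 1]` is either critical for `G^[j]` or a zero of
    -- `det DG ∘ G^[j]` in the set where `G^[j]` is a local diffeomorphism. On that set the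
    -- nondegeneracy of `det DG` pulls back.
    have key := ae_countable_line_inter t (O := {x | (fderiv ℝ (G^[j]) x).det ≠ 0})
      (h := fun x => (fderiv ℝ G (G^[j] x)).det) (fun x _ => hh.contDiffAt) ?_
    · filter_upwards [ih, key] with x h1 h2
      refine (h1.union h2).mono fun s hs => ?_
      by_cases h3 : (fderiv ℝ (G^[j]) (x + s • EuclideanSpace.single t (1 : ℝ))).det = 0
      · exact Or.inl h3
      · refine Or.inr ⟨h3, ?_⟩
        rw [mem_ofPred_eq, (hasFDerivAt_iterate hG j _).fderiv] at hs
        have h4 : LinearMap.det ((fderiv ℝ G (G^[j] (x + s • EuclideanSpace.single t (1 : ℝ))) :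
            Vec n →ₗ[ℝ] Vec n) ∘ₗ
            (fderiv ℝ (G^[j]) (x + s • EuclideanSpace.single t (1 : ℝ)) :
              Vec n →ₗ[ℝ] Vec n)) = 0 := hs
        rw [LinearMap.det_comp, mul_eq_zero] at h4
        exact h4.resolve_right h3
    · intro x hx h0 h1
      apply hne _ h0
      have h2 : HasFDerivAt (fun x => (fderiv ℝ G (G^[j] x)).det)
          ((fderiv ℝ (fun y => (fderiv ℝ G y).det) (G^[j] x)).comp (fderiv ℝ (G^[j]) x)) x :=
        ((hD.differentiable one_ne_zero) _).hasFDerivAt.comp x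
          ((hGj.differentiable two_ne_zero) x).hasFDerivAt
      rw [h2.fderiv] at h1
      ext v
      have hx' := (fderiv ℝ (G^[j]) x).coe_toContinuousLinearEquivOfDetNeZero hx
      obtain ⟨w, rfl⟩ := ((fderiv ℝ (G^[j]) x).toContinuousLinearEquivOfDetNeZero hx).surjective v
      rw [ContinuousLinearMap.toContinuousLinearEquivOfDetNeZero_apply]
      exact congrArg (fun L : Vec n →L[ℝ] ℝ => L w) h1

/-- An iterate of a `C²` map sends neighbourhoods of a regular point to neighbourhoods. -/
lemma iterate_image_mem_nhds {n : ℕ} {G : Vec n → Vec n} (hG : ContDiff ℝ 2 G) (j : ℕ)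
    {x : Vec n} (hx : (fderiv ℝ (G^[j]) x).det ≠ 0) {U : Set (Vec n)} (hU : U ∈ 𝓝 x) :
    G^[j] '' U ∈ 𝓝 (G^[j] x) := by
  have h1 : HasStrictFDerivAt (G^[j])
      ((fderiv ℝ (G^[j]) x).toContinuousLinearEquivOfDetNeZero hx : Vec n →L[ℝ] Vec n) x := by
    rw [ContinuousLinearMap.coe_toContinuousLinearEquivOfDetNeZero]
    exact (contDiff_iterate hG j).contDiffAt.hasStrictFDerivAt two_ne_zero
  rw [← h1.map_nhds_eq_of_equiv]
  exact image_mem_map hU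

/-! ### The linear part, the cone field and the properties that imply transitivity. -/

/-- The diagonal linear map `(x₁, …, xₘ) ↦ (8 x₁, 2 x₂, …, 2 xₘ)`. -/
def stretch (m : ℕ) : Vec (m + 1) →L[ℝ] Vec (m + 1) :=
  LinearMap.toContinuousLinearMap
    { toFun := fun x => WithLp.toLp 2 fun i => (if i = 0 then 8 else 2) * x i
      map_add' := fun x y => by ext i; simp [mul_add]
      map_smul' := fun c x => by ext i; simp [mul_left_comm] }

@[simp] lemma stretch_apply {m : ℕ} (x : Vec (m + 1)) (i : Fin (m + 1)) :
    stretch m x i = (if i = 0 then 8 else 2) * x i := rfl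

lemma abs_apply_le_norm {n : ℕ} (v : Vec n) (i : Fin n) : |v i| ≤ ‖v‖ := by
  simpa using PiLp.norm_apply_le v i

lemma norm_le_sum_abs {n : ℕ} (v : Vec n) : ‖v‖ ≤ ∑ i, |v i| := by
  have hv : v = ∑ i, v i • EuclideanSpace.single i (1 : ℝ) := by
    ext j
    simp [Finset.sum_apply, Pi.single_apply]
  calc ‖v‖ = ‖∑ i, v i • EuclideanSpace.single i (1 : ℝ)‖ := by rw [← hv]
    _ ≤ ∑ i, ‖v i • EuclideanSpace.single i (1 : ℝ)‖ := norm_sum_le _ _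
    _ = ∑ i, |v i| := by simp [norm_smul]

lemma norm_le_norm_of_abs_le {n : ℕ} {v w : Vec n} (h : ∀ i, |v i| ≤ |w i|) : ‖v‖ ≤ ‖w‖ := by
  rw [EuclideanSpace.norm_eq, EuclideanSpace.norm_eq]
  apply Real.sqrt_le_sqrt
  gcongr with i
  simpa using h i

lemma two_mul_norm_le_norm_stretch {m : ℕ} (v : Vec (m + 1)) : 2 * ‖v‖ ≤ ‖stretch m v‖ := by
  have : ‖(2 : ℝ) • v‖ ≤ ‖stretch m v‖ := by
    apply norm_le_norm_of_abs_le
    intro i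
    simp only [PiLp.smul_apply, smul_eq_mul, stretch_apply, abs_mul]
    gcongr
    split_ifs <;> norm_num
  simpa [norm_smul] using this

lemma norm_stretch_le {m : ℕ} (v : Vec (m + 1)) : ‖stretch m v‖ ≤ 8 * ‖v‖ := by
  have : ‖stretch m v‖ ≤ ‖(8 : ℝ) • v‖ := by
    apply norm_le_norm_of_abs_le
    intro i
    simp only [PiLp.smul_apply, smul_eq_mul, stretch_apply, abs_mul]
    gcongr
    split_ifs <;> norm_num
  simpa [norm_smul] using this

/-- The inverse of `stretch`. -/
def unstretch {m : ℕ} (y : Vec (m + 1)) : Vec (m + 1) :=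
  WithLp.toLp 2 fun i => y i / (if i = 0 then 8 else 2)

lemma stretch_unstretch {m : ℕ} (y : Vec (m + 1)) : stretch m (unstretch y) = y := by
  ext i
  simp only [stretch_apply, unstretch]
  split_ifs <;> ring

/-- `stretch` as a linear equivalence. -/
def stretchEquiv (m : ℕ) : Vec (m + 1) ≃L[ℝ] Vec (m + 1) :=
  ContinuousLinearEquiv.ofBijective (stretch m)
    (LinearMap.ker_eq_bot'.2 fun v hv => by
      have := two_mul_norm_le_norm_stretch v
      rw [show stretch m v = 0 from hv, norm_zero] at this
      exact norm_le_zero_iff.1 (by linarith))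
    (LinearMap.range_eq_top.2 fun y => ⟨_, stretch_unstretch y⟩)

lemma coe_stretchEquiv (m : ℕ) :
    (stretchEquiv m : Vec (m + 1) →L[ℝ] Vec (m + 1)) = stretch m := rfl

/-- The cone field around the first axis; the last coordinate has the weight `κ`. -/
def InCone {d : ℕ} (κ : ℝ) (v : Vec (d + 2)) : Prop :=
  (∀ k : Fin (d + 1), |v k.castSucc| ≤ v 0) ∧ κ * |v (Fin.last (d + 1))| ≤ v 0

/-- The properties of the lifts near the model map from which transitivity is derived. -/
structure IsExpandingLift {d : ℕ} (G : Vec (d + 2) → Vec (d + 2)) : Prop where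
  smooth : ContDiff ℝ 2 G
  det_smooth : ContDiff ℝ 1 fun x => (fderiv ℝ G x).det
  nondegenerate : ∀ x, (fderiv ℝ G x).det = 0 → fderiv ℝ (fun y => (fderiv ℝ G y).det) x ≠ 0
  first : ∀ x, |G x 0 - 8 * x 0| ≤ 1 / 100
  cone : ∃ κ : ℝ, 0 < κ ∧ ∀ x v, InCone κ v →
    InCone κ (fderiv ℝ G x v) ∧ 7 * v 0 ≤ fderiv ℝ G x v 0
  close : ∀ (N : ℤ) (x : Vec (d + 2)), x 0 ∈ Icc (N + 2 / 5 : ℝ) (N + 3 / 5) →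
    ‖G x - stretch (d + 1) x‖ ≤ 1 / 100
  close_lipschitz : ∀ (N : ℤ) (x y : Vec (d + 2)), x 0 ∈ Icc (N + 2 / 5 : ℝ) (N + 3 / 5) →
    y 0 ∈ Icc (N + 2 / 5 : ℝ) (N + 3 / 5) →
    ‖G x - G y - stretch (d + 1) (x - y)‖ ≤ 1 / 10 * ‖x - y‖

/-! ### Symbolic dynamics of the first coordinate. -/

/-- The integer parts along the itinerary `β`. -/
def itinerary (N : ℤ) (β : ℕ → Bool) : ℕ → ℤ
  | 0 => N
  | j + 1 => 8 * itinerary N β j + bif β j then 4 else 3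

lemma exists_Icc_subset_of_strictMono {f : ℝ → ℝ} (hf : StrictMono f) (hc : Continuous f)
    {a b lo hi : ℝ} (hab : a ≤ b) (hlh : lo ≤ hi) (ha : f a ≤ lo) (hb : hi ≤ f b) :
    ∃ a' b', a ≤ a' ∧ a' ≤ b' ∧ b' ≤ b ∧ f a' = lo ∧ f b' = hi := by
  obtain ⟨a', ha', hfa⟩ := intermediate_value_Icc hab hc.continuousOn
    (show lo ∈ Icc (f a) (f b) from ⟨ha, hlh.trans hb⟩)
  obtain ⟨b', hb', hfb⟩ := intermediate_value_Icc hab hc.continuousOn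
    (show hi ∈ Icc (f a) (f b) from ⟨ha.trans hlh, hb⟩)
  refine ⟨a', b', ha'.1, ?_, hb'.2, hfa, hfb⟩
  rw [← hf.le_iff_le, hfa, hfb]; exact hlh

/-- Every itinerary is realised in an interval whose image crosses the central interval. -/
lemma exists_itinerary {f : ℕ → ℝ → ℝ} (hf : ∀ j, StrictMono (f j)) (hc : ∀ j, Continuous (f j))
    (hstep : ∀ j s, |f (j + 1) s - 8 * f j s| ≤ 1 / 100) {a b : ℝ} (hab : a ≤ b) {N : ℤ}
    (ha : f 0 a ≤ N + 21 / 50) (hb : N + 29 / 50 ≤ f 0 b) (β : ℕ → Bool) :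
    ∃ s ∈ Icc a b, ∀ j, f j s ∈
      Icc ((itinerary N β j : ℝ) + 21 / 50) ((itinerary N β j : ℝ) + 29 / 50) := by
  set I : ℕ → Set ℝ := fun j =>
    Icc ((itinerary N β j : ℝ) + 21 / 50) ((itinerary N β j : ℝ) + 29 / 50) with hI
  have main : ∀ j, ∃ a' b', a ≤ a' ∧ a' ≤ b' ∧ b' ≤ b ∧ f j a' = itinerary N β j + 21 / 50 ∧
      f j b' = itinerary N β j + 29 / 50 ∧ ∀ i ≤ j, ∀ s ∈ Icc a' b', f i s ∈ I i := by
    have mem : ∀ j a' b', f j a' = itinerary N β j + 21 / 50 →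
        f j b' = itinerary N β j + 29 / 50 → ∀ s ∈ Icc a' b', f j s ∈ I j := by
      intro j a' b' h1 h2 s hs
      exact ⟨h1 ▸ (hf j).monotone hs.1, h2 ▸ (hf j).monotone hs.2⟩
    intro j
    induction j with
    | zero =>
      obtain ⟨a', b', h1, h2, h3, h4, h5⟩ :=
        exists_Icc_subset_of_strictMono (hf 0) (hc 0) hab (by linarith) ha hb
      refine ⟨a', b', h1, h2, h3, h4, h5, fun i hi s hs => ?_⟩
      obtain rfl : i = 0 := by omega
      exact mem 0 a' b' h4 h5 s hs
    | succ j ih =>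
      obtain ⟨a₁, b₁, h1, h2, h3, h4, h5, h6⟩ := ih
      have ea := abs_le.1 (hstep j a₁)
      have eb := abs_le.1 (hstep j b₁)
      have hN : (itinerary N β (j + 1) : ℝ) = 8 * itinerary N β j + 3 ∨
          (itinerary N β (j + 1) : ℝ) = 8 * itinerary N β j + 4 := by
        simp only [itinerary]
        cases β j <;> simp
      rw [h4] at ea
      rw [h5] at eb
      -- Multiplying by 8 sends `[N + 21/50, N + 29/50]` to `[8N + 3.36, 8N + 4.64]`. Even with an
      -- error of `1/100` this contains the central intervals over both `8N + 3` and `8N + 4`.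
      obtain ⟨a', b', g1, g2, g3, g4, g5⟩ :=
        exists_Icc_subset_of_strictMono (hf (j + 1)) (hc (j + 1)) h2
        (lo := itinerary N β (j + 1) + 21 / 50) (hi := itinerary N β (j + 1) + 29 / 50)
        (by linarith) (by rcases hN with h | h <;> linarith [ea.2])
        (by rcases hN with h | h <;> linarith [eb.1])
      refine ⟨a', b', h1.trans g1, g2, g3.trans h3, g4, g5, fun i hi s hs => ?_⟩
      rcases Nat.lt_or_ge i (j + 1) with hi' | hi'
      · exact h6 i (by omega) s ⟨g1.trans hs.1, hs.2.trans g3⟩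
      · obtain rfl : i = j + 1 := by omega
        exact mem _ a' b' g4 g5 s hs
  set K : ℕ → Set ℝ := fun j => Icc a b ∩ ⋂ i ≤ j, f i ⁻¹' I i with hK
  have hKc : ∀ j, IsClosed (K j) := fun j =>
    isClosed_Icc.inter (isClosed_biInter fun i _ => isClosed_Icc.preimage (hc i))
  obtain ⟨s, hs⟩ := IsCompact.nonempty_iInter_of_sequence_nonempty_isCompact_isClosed K
    (fun j => inter_subset_inter_right _
      (biInter_subset_biInter_left fun i (hi : i ≤ j) => hi.trans j.le_succ))
    (fun j => by
      obtain ⟨a', b', h1, h2, h3, h4, h5, h6⟩ := main j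
      exact ⟨a', ⟨h1, h2.trans h3⟩, mem_iInter₂.2 fun i hi => h6 i hi a' ⟨le_rfl, h2⟩⟩)
    (isCompact_Icc.inter_right
      (isClosed_biInter fun i _ => isClosed_Icc.preimage (hc i))) hKc
  rw [mem_iInter] at hs
  exact ⟨s, (hs 0).1, fun j => mem_iInter₂.1 (hs j).2 j le_rfl⟩

lemma itinerary_injective {N : ℤ} {x : ℕ → ℝ} {β β' : ℕ → Bool}
    (h : ∀ j, x j ∈ Icc ((itinerary N β j : ℝ) + 21 / 50) ((itinerary N β j : ℝ) + 29 / 50))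
    (h' : ∀ j, x j ∈ Icc ((itinerary N β' j : ℝ) + 21 / 50) ((itinerary N β' j : ℝ) + 29 / 50)) :
    β = β' := by
  have key : ∀ j, itinerary N β j = itinerary N β' j := by
    intro j
    have h1 := h j
    have h2 := h' j
    have h3 : (itinerary N β j : ℝ) < itinerary N β' j + 1 := by linarith [h1.1, h2.2]
    have h4 : (itinerary N β' j : ℝ) < itinerary N β j + 1 := by linarith [h2.1, h1.2]
    norm_cast at h3 h4
    omega
  funext j
  have h1 := key (j + 1)
  simp only [itinerary, key j] at h1
  cases hb : β j <;> cases hb' : β' j <;> simp [hb, hb'] at h1 ⊢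

/-- The points that realise the various itineraries are uncountably many, so one of them lies
outside a given countable set. -/
lemma exists_itinerary_notMem {f : ℕ → ℝ → ℝ} (hf : ∀ j, StrictMono (f j))
    (hc : ∀ j, Continuous (f j))
    (hstep : ∀ j s, |f (j + 1) s - 8 * f j s| ≤ 1 / 100) {a b : ℝ} (hab : a ≤ b) {N : ℤ}
    (ha : f 0 a ≤ N + 21 / 50) (hb : N + 29 / 50 ≤ f 0 b) {C : Set ℝ} (hC : C.Countable) :
    ∃ β : ℕ → Bool, ∃ s ∈ Icc a b, s ∉ C ∧ ∀ j, f j s ∈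
      Icc ((itinerary N β j : ℝ) + 21 / 50) ((itinerary N β j : ℝ) + 29 / 50) := by
  choose S hS hSf using exists_itinerary hf hc hstep hab ha hb
  by_contra! hcon
  have hSC : ∀ β, S β ∈ C := by
    intro β
    by_contra h
    obtain ⟨j, hj⟩ := hcon β (S β) (hS β) h
    exact hj (hSf β j)
  have hinj : Function.Injective fun β => (⟨S β, hSC β⟩ : C) := by
    intro β β' h
    have h0 : S β = S β' := congrArg Subtype.val h
    exact itinerary_injective (x := fun j => f j (S β)) (hSf β) fun j => h0 ▸ hSf β' j
  have := hC.to_subtype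
  have := hinj.countable
  -- Cantor's diagonal argument against countability of the itineraries.
  obtain ⟨e, he⟩ := exists_surjective_nat (ℕ → Bool)
  obtain ⟨j, hj⟩ := he fun i => !(e i i)
  simpa using congrFun hj j


/-! ### From an expanding lift to transitivity. -/

section Dynamics

variable {d : ℕ} {G : Vec (d + 2) → Vec (d + 2)}

/-- On the slab `G` is a Lipschitz perturbation, with constant `1/10`, of a linear map whose inverse
has norm at most `1/2`. The quantitative inverse function theorem therefore covers a ball of radius
at least `(2 - 1/10)/50` around `G b`, where `b` is the linear preimage of `Y`, and `Y` is within
`1/100` of `G b`. -/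
lemma IsExpandingLift.exists_inverse (hG : IsExpandingLift G) (N : ℤ) {Y : Vec (d + 2)}
    (hY : Y 0 ∈ Icc (8 * N + 171 / 50 : ℝ) (8 * N + 229 / 50)) :
    ∃ X : Vec (d + 2), X 0 ∈ Icc (N + 21 / 50 : ℝ) (N + 29 / 50) ∧ G X = Y := by
  set slab : Set (Vec (d + 2)) := {x | x 0 ∈ Icc (N + 2 / 5 : ℝ) (N + 3 / 5)} with hslab
  have happ : ApproximatesLinearOn G (stretchEquiv (d + 1) : Vec (d + 2) →L[ℝ] Vec (d + 2)) slab
      (1 / 10) := by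
    intro x hx y hy
    simpa only [coe_stretchEquiv, NNReal.coe_div, NNReal.coe_one, NNReal.coe_ofNat] using
      hG.close_lipschitz N x y hx hy
  set b := unstretch Y with hb
  have hb0 : b 0 = Y 0 / 8 := by simp [hb, unstretch]
  have hball : Metric.closedBall b (1 / 50) ⊆ slab := by
    intro x hx
    have h1 := (abs_apply_le_norm (x - b) 0).trans (mem_closedBall_iff_norm.1 hx)
    have h2 := abs_le.1 h1
    simp only [PiLp.sub_apply, hb0] at h2
    constructor <;> linarith [hY.1, hY.2, h2.1, h2.2]
  have hnn : ((stretchEquiv (d + 1)).toNonlinearRightInverse.nnnorm : ℝ) ≤ 1 / 2 := by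
    change ‖((stretchEquiv (d + 1)).symm : Vec (d + 2) →L[ℝ] Vec (d + 2))‖ ≤ 1 / 2
    refine ContinuousLinearMap.opNorm_le_bound _ (by norm_num) fun y => ?_
    have h1 := two_mul_norm_le_norm_stretch ((stretchEquiv (d + 1)).symm y)
    have h2 : stretch (d + 1) ((stretchEquiv (d + 1)).symm y) = y :=
      (stretchEquiv (d + 1)).apply_symm_apply y
    rw [h2] at h1
    change ‖(stretchEquiv (d + 1)).symm y‖ ≤ _
    linarith
  have hpos : 0 < ((stretchEquiv (d + 1)).toNonlinearRightInverse.nnnorm : ℝ) := by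
    change 0 < ‖((stretchEquiv (d + 1)).symm : Vec (d + 2) →L[ℝ] Vec (d + 2))‖
    exact (stretchEquiv (d + 1)).norm_symm_pos
  have hsurj := happ.surjOn_closedBall_of_nonlinearRightInverse
    (stretchEquiv (d + 1)).toNonlinearRightInverse (by norm_num : (0 : ℝ) ≤ 1 / 50) hball
  have hY' : Y ∈ Metric.closedBall (G b)
      ((((stretchEquiv (d + 1)).toNonlinearRightInverse.nnnorm : ℝ)⁻¹ - ((1 / 10 : NNReal) : ℝ))
        * (1 / 50)) := by
    have h1 := hG.close N b (hball (Metric.mem_closedBall_self (by norm_num)))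
    rw [hb, stretch_unstretch, ← hb] at h1
    rw [mem_closedBall_iff_norm, norm_sub_rev]
    have h2 : (2 : ℝ) ≤ ((stretchEquiv (d + 1)).toNonlinearRightInverse.nnnorm : ℝ)⁻¹ := by
      rw [le_inv_comm₀ two_pos hpos]; simpa using hnn
    push_cast
    linarith
  obtain ⟨X, hX, hXY⟩ := hsurj hY'
  refine ⟨X, ?_, hXY⟩
  -- As `8 X₀` is within `1/100` of `Y₀`, the preimage lies in the narrow slab, so inverse branches
  -- can be iterated.
  have h1 := abs_le.1 (hG.first X)
  rw [hXY] at h1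
  constructor <;> linarith [hY.1, hY.2, h1.1, h1.2]

lemma IsExpandingLift.expand (hG : IsExpandingLift G) {N : ℤ} {x y : Vec (d + 2)}
    (hx : x 0 ∈ Icc (N + 21 / 50 : ℝ) (N + 29 / 50))
    (hy : y 0 ∈ Icc (N + 21 / 50 : ℝ) (N + 29 / 50)) :
    19 / 10 * ‖x - y‖ ≤ ‖G x - G y‖ := by
  have h1 := hG.close_lipschitz N x y ⟨by linarith [hx.1], by linarith [hx.2]⟩
    ⟨by linarith [hy.1], by linarith [hy.2]⟩
  have h2 := two_mul_norm_le_norm_stretch (x - y)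
  have h3 := norm_sub_le (G x - G y) (G x - G y - stretch (d + 1) (x - y))
  rw [sub_sub_cancel] at h3
  linarith

/-- Inverse branches are composed along the itinerary of `q`; each contracts the distance to the
orbit of `q` by `19/10`. -/
lemma IsExpandingLift.pull_back (hG : IsExpandingLift G) {q : Vec (d + 2)} {N : ℕ → ℤ}
    (hN : ∀ j, N (j + 1) = 8 * N j + 3 ∨ N (j + 1) = 8 * N j + 4)
    (hq : ∀ j, (G^[j] q) 0 ∈ Icc ((N j : ℝ) + 21 / 50) (N j + 29 / 50)) (m : ℕ) :
    ∀ Y : Vec (d + 2), Y 0 ∈ Icc ((N m : ℝ) + 21 / 50) (N m + 29 / 50) →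
      ∃ X, G^[m] X = Y ∧ (19 / 10) ^ m * ‖X - q‖ ≤ ‖Y - G^[m] q‖ := by
  induction m with
  | zero => intro Y _; exact ⟨Y, rfl, by simp⟩
  | succ m ih =>
    intro Y hY
    have hN' : (N (m + 1) : ℝ) = 8 * N m + 3 ∨ (N (m + 1) : ℝ) = 8 * N m + 4 := by
      exact_mod_cast hN m
    obtain ⟨Z, hZ, hZY⟩ := hG.exists_inverse (N m) (Y := Y) (by
      rcases hN' with h | h <;> rw [h] at hY <;>
        exact ⟨by linarith [hY.1], by linarith [hY.2]⟩)
    obtain ⟨X, hX, hXq⟩ := ih Z hZ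
    refine ⟨X, by rw [Function.iterate_succ_apply', hX, hZY], ?_⟩
    have h1 := hG.expand hZ (hq m)
    rw [hZY, ← Function.iterate_succ_apply' G m q] at h1
    rw [pow_succ]
    linarith

lemma toTorus_add_int {n : ℕ} (x : Vec n) (a : Fin n → ℤ) :
    toTorus (x + WithLp.toLp 2 fun i => (a i : ℝ)) = toTorus x := by
  funext i
  simp [toTorus]

lemma toTorus_surjective {n : ℕ} : Function.Surjective (toTorus : Vec n → Torus n) := by
  intro y
  choose x hx using fun i => QuotientAddGroup.mk_surjective (y i)
  exact ⟨WithLp.toLp 2 x, funext hx⟩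

/-- A point of the torus has a lift within distance `1/2` of a given point in each coordinate. -/
lemma exists_lift_near {n : ℕ} (y : Torus n) (c : Vec n) :
    ∃ Y, toTorus Y = y ∧ ∀ i, |Y i - c i| ≤ 1 / 2 := by
  obtain ⟨x, rfl⟩ := toTorus_surjective y
  refine ⟨_, toTorus_add_int x fun i => - round (x i - c i), fun i => ?_⟩
  have := abs_sub_round (x i - c i)
  simp only [PiLp.add_apply, Int.cast_neg]
  rwa [← sub_eq_add_neg, sub_right_comm]

lemma iterate_toTorus {n : ℕ} {G : Vec n → Vec n} {g : Torus n → Torus n} (h : IsLift G g) (m : ℕ)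
    (x : Vec n) : toTorus (G^[m] x) = g^[m] (toTorus x) := by
  induction m with
  | zero => rfl
  | succ m ih => rw [Function.iterate_succ_apply', Function.iterate_succ_apply', h, ih]

/-- The preorbits of every point accumulate at the points whose orbit stays in the slabs. -/
lemma IsExpandingLift.exists_preorbit (hG : IsExpandingLift G) {q : Vec (d + 2)} {N : ℕ → ℤ}
    (hN : ∀ j, N (j + 1) = 8 * N j + 3 ∨ N (j + 1) = 8 * N j + 4)
    (hq : ∀ j, (G^[j] q) 0 ∈ Icc ((N j : ℝ) + 21 / 50) (N j + 29 / 50)) (y : Torus (d + 2))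
    {s : ℝ} (hs : 0 < s) :
    ∃ X, ‖X - q‖ < s ∧ ∃ m, toTorus (G^[m] X) = y := by
  set C : ℝ := ∑ _i : Fin (d + 2), (2 : ℝ) with hC
  obtain ⟨m, hm⟩ := pow_unbounded_of_one_lt (C / s) (by norm_num : (1 : ℝ) < 19 / 10)
  -- The lift `Y` of `y` is chosen near the orbit of `q`, except that its first coordinate is
  -- centred at `8 N m + 4`. Within `1/2` of this centre it is in the range of the inverse branch
  -- over slab `N m`, whatever `y` is. The distance to the orbit stays below a constant independent
  -- of `m`.
  set c : Vec (d + 2) := WithLp.toLp 2 fun i => if i = 0 then 8 * (N m : ℝ) + 4 else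
    G (G^[m] q) i with hc
  obtain ⟨Y, hYy, hY⟩ := exists_lift_near y c
  have hY0 := abs_le.1 (hY 0)
  simp only [hc, if_true] at hY0
  obtain ⟨Z, hZ, hZY⟩ := hG.exists_inverse (N m) (Y := Y)
    ⟨by linarith [hY0.1], by linarith [hY0.2]⟩
  obtain ⟨X, hX, hXq⟩ := hG.pull_back hN hq m Z hZ
  refine ⟨X, ?_, m + 1, by rw [Function.iterate_succ_apply', hX, hZY, hYy]⟩
  have h1 := hG.expand hZ (hq m)
  rw [hZY] at h1
  have h2 : ‖Y - G (G^[m] q)‖ ≤ C := by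
    refine (norm_le_sum_abs _).trans (Finset.sum_le_sum fun i _ => ?_)
    have h3 := hY i
    simp only [PiLp.sub_apply]
    by_cases hi : i = 0
    · subst hi
      have h4 := abs_le.1 (hG.first (G^[m] q))
      have h5 := hq m
      rw [abs_le]
      constructor <;> linarith [h5.1, h5.2, h4.1, h4.2, hY0.1, hY0.2]
    · simp only [hc, hi, if_false] at h3
      linarith
  rw [div_lt_iff₀ hs] at hm
  have h3 : (19 / 10 : ℝ) ^ m * ‖X - q‖ < (19 / 10) ^ m * s := by
    nlinarith [norm_nonneg (Z - G^[m] q)]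
  exact lt_of_mul_lt_mul_left h3 (by positivity)

/-- The first coordinate of the iterates along a line parallel to the first axis. -/
lemma IsExpandingLift.exists_deriv (hG : IsExpandingLift G) (j : ℕ) (x : Vec (d + 2)) (s : ℝ) :
    ∃ c, (7 : ℝ) ^ j ≤ c ∧
      HasDerivAt (fun u : ℝ => G^[j] (x + u • EuclideanSpace.single 0 (1 : ℝ)) 0) c s := by
  obtain ⟨κ, hκ, hcone⟩ := hG.cone
  set z := x + s • EuclideanSpace.single 0 (1 : ℝ) with hz
  have key : InCone κ (fderiv ℝ (G^[j]) z (EuclideanSpace.single 0 1)) ∧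
      (7 : ℝ) ^ j ≤ fderiv ℝ (G^[j]) z (EuclideanSpace.single 0 1) 0 := by
    induction j with
    | zero =>
      constructor
      · rw [Function.iterate_zero, fderiv_id]
        refine ⟨fun k => ?_, ?_⟩
        · simp only [ContinuousLinearMap.coe_id', id, PiLp.single_apply]
          split_ifs <;> simp
        · simp [Fin.last_eq_zero_iff]
      · simp
    | succ j ih =>
      rw [(hasFDerivAt_iterate hG.smooth j z).fderiv, ContinuousLinearMap.comp_apply]
      obtain ⟨h1, h2⟩ := hcone (G^[j] z) _ ih.1
      exact ⟨h1, by rw [pow_succ]; linarith [ih.2]⟩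
  refine ⟨_, key.2, ?_⟩
  have h3 : HasDerivAt (fun u : ℝ => x + u • EuclideanSpace.single (0 : Fin (d + 2)) (1 : ℝ))
      (EuclideanSpace.single 0 (1 : ℝ)) s := by
    simpa using ((hasDerivAt_id s).smul_const
      (EuclideanSpace.single (0 : Fin (d + 2)) (1 : ℝ))).const_add x
  have h4 := (((contDiff_iterate hG.smooth j).differentiable two_ne_zero) z).hasFDerivAt
  exact (EuclideanSpace.proj (0 : Fin (d + 2)) : Vec (d + 2) →L[ℝ] ℝ).hasFDerivAt.comp_hasDerivAt s
    (h4.comp_hasDerivAt s h3)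

lemma IsExpandingLift.mul_sub_le (hG : IsExpandingLift G) (j : ℕ) (x : Vec (d + 2)) {a b : ℝ}
    (hab : a ≤ b) :
    7 ^ j * (b - a) ≤ G^[j] (x + b • EuclideanSpace.single 0 (1 : ℝ)) 0 -
      G^[j] (x + a • EuclideanSpace.single 0 (1 : ℝ)) 0 := by
  choose c hc hd using hG.exists_deriv j x
  refine mul_sub_le_image_sub_of_le_deriv (f := fun u : ℝ =>
    G^[j] (x + u • EuclideanSpace.single 0 (1 : ℝ)) 0) (fun s => (hd s).differentiableAt)
    (fun s => ?_) hab
  rw [(hd s).deriv]; exact hc s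

/-- The forward orbit of a nonempty open set covers the torus. -/
theorem IsExpandingLift.exists_iterate_eq (hG : IsExpandingLift G) {U : Set (Vec (d + 2))}
    (hU : IsOpen U) (hne : U.Nonempty) (y : Torus (d + 2)) :
    ∃ x ∈ U, ∃ m, toTorus (G^[m] x) = y := by
  obtain ⟨x₀, hx₀⟩ := hne
  obtain ⟨s, hs, hball⟩ := Metric.isOpen_iff.1 hU x₀ hx₀
  -- With this `k` a segment of length `s / 2` gets an image whose first coordinate spans more than
  -- 2, enough to cross the central interval above the ceiling of its left end.
  obtain ⟨k, hk⟩ := pow_unbounded_of_one_lt (4 / s) (by norm_num : (1 : ℝ) < 7)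
  have hae := ae_countable_iterate_critical (0 : Fin (d + 2)) hG.smooth hG.det_smooth
    hG.nondegenerate k
  obtain ⟨x, hxb, hx⟩ : ∃ x ∈ Metric.ball x₀ (s / 2), {s : ℝ | (fderiv ℝ (G^[k])
      (x + s • EuclideanSpace.single (0 : Fin (d + 2)) (1 : ℝ))).det = 0}.Countable := by
    by_contra! hcon
    have h0 : volume (Metric.ball x₀ (s / 2)) = 0 :=
      measure_mono_null (fun x hx => hcon x hx) (ae_iff.1 hae)
    exact (Metric.measure_ball_pos volume x₀ (half_pos hs)).ne' h0
  set γ : ℝ → Vec (d + 2) := fun u => x + u • EuclideanSpace.single 0 (1 : ℝ) with hγ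
  have hγc : Continuous γ := by fun_prop
  have hγU : ∀ u ∈ Icc 0 (s / 2), γ u ∈ U := by
    intro u hu
    apply hball
    have h1 : dist (γ u) x = u := by
      simp [hγ, norm_smul, abs_of_nonneg hu.1]
    have h2 := dist_triangle (γ u) x x₀
    rw [h1] at h2
    rw [Metric.mem_ball] at hxb ⊢
    linarith [hu.2]
  have hlong := hG.mul_sub_le k x (half_pos hs).le
  rw [sub_zero] at hlong
  rw [div_lt_iff₀ hs] at hk
  set f : ℕ → ℝ → ℝ := fun j u => G^[j + k] (γ u) 0 with hf
  have hmono : ∀ j, StrictMono (f j) := by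
    intro j a b hab
    have h1 := hG.mul_sub_le (j + k) x hab.le
    have h2 : (0 : ℝ) < 7 ^ (j + k) * (b - a) := by
      have := sub_pos.2 hab
      positivity
    simp only [hf, hγ]
    linarith
  have hcont : ∀ j, Continuous (f j) := fun j =>
    (EuclideanSpace.proj (0 : Fin (d + 2)) : Vec (d + 2) →L[ℝ] ℝ).continuous.comp
      ((contDiff_iterate hG.smooth (j + k)).continuous.comp hγc)
  have hstep : ∀ j u, |f (j + 1) u - 8 * f j u| ≤ 1 / 100 := by
    intro j u
    have := hG.first (G^[j + k] (γ u))
    simp only [hf]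
    rw [show j + 1 + k = (j + k) + 1 by ring, Function.iterate_succ_apply']
    exact this
  have hN1 := Int.le_ceil (f 0 0)
  have hN2 := Int.ceil_lt_add_one (f 0 0)
  have hlong' : 2 ≤ f 0 (s / 2) - f 0 0 := by
    simp only [hf, hγ, zero_add]
    linarith
  -- The excluded countable set consists of the critical parameters of `G^[k]` only; later iterates
  -- need no regularity because preimages are produced by inverse branches.
  obtain ⟨β, u, hu, huC, hitin⟩ := exists_itinerary_notMem hmono hcont hstep (half_pos hs).le
    (N := ⌈f 0 0⌉) (by linarith) (by linarith) hx
  have hnhds := iterate_image_mem_nhds hG.smooth k huC (hU.mem_nhds (hγU u hu))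
  obtain ⟨ρ, hρ, hsub⟩ := Metric.mem_nhds_iff.1 hnhds
  obtain ⟨X, hX, m, hm⟩ := hG.exists_preorbit (q := G^[k] (γ u)) (N := itinerary ⌈f 0 0⌉ β)
    (fun j => by simp only [itinerary]; cases β j <;> simp)
    (fun j => by rw [← Function.iterate_add_apply]; exact hitin j) y hρ
  obtain ⟨w, hw, hwX⟩ := hsub (mem_ball_iff_norm.2 hX)
  exact ⟨w, hw, m + k, by rw [Function.iterate_add_apply, hwX, hm]⟩

lemma continuous_toTorus {n : ℕ} : Continuous (toTorus : Vec n → Torus n) := by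
  refine continuous_pi fun i => ?_
  exact (AddCircle.continuous_mk' 1).comp (EuclideanSpace.proj (𝕜 := ℝ) i).continuous

lemma isOpenQuotientMap_toTorus {n : ℕ} : IsOpenQuotientMap (toTorus : Vec n → Torus n) :=
  (IsOpenQuotientMap.piMap fun _ : Fin n => QuotientAddGroup.isOpenQuotientMap_mk
    (N := AddSubgroup.zmultiples (1 : ℝ))).comp
    (EuclideanSpace.equiv (Fin n) ℝ).toHomeomorph.isOpenQuotientMap

/-- Topological transitivity yields a dense forward orbit. -/
lemma isTransitive_of_forall_exists {X : Type*} [TopologicalSpace X] [BaireSpace X]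
    [SecondCountableTopology X] [Nonempty X] {g : X → X} (hg : Continuous g)
    (h : ∀ U V : Set X, IsOpen U → U.Nonempty → IsOpen V → V.Nonempty →
      ∃ x ∈ U, ∃ m, g^[m] x ∈ V) : IsTransitive g := by
  obtain ⟨B, hBc, hB0, hB⟩ := TopologicalSpace.exists_countable_basis X
  have hne : ∀ V ∈ B, V.Nonempty := fun V hV => nonempty_iff_ne_empty.2 fun h0 => hB0 (h0 ▸ hV)
  have hdense : Dense (⋂ V ∈ B, ⋃ m, g^[m] ⁻¹' V) := by
    refine dense_biInter_of_isOpen (fun V hV => isOpen_iUnion fun m =>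
      (hB.isOpen hV).preimage (hg.iterate m)) hBc fun V hV => ?_
    refine dense_iff_inter_open.2 fun U hU hUne => ?_
    obtain ⟨x, hx, m, hm⟩ := h U V hU hUne (hB.isOpen hV) (hne V hV)
    exact ⟨x, hx, mem_iUnion.2 ⟨m, hm⟩⟩
  obtain ⟨x, hx⟩ := hdense.nonempty
  refine ⟨x, hB.dense_iff.2 fun V hV _ => ?_⟩
  obtain ⟨m, hm⟩ := mem_iUnion.1 (mem_iInter₂.1 hx V hV)
  exact ⟨_, hm, m, rfl⟩

theorem IsExpandingLift.isTransitive (hG : IsExpandingLift G) {g : Torus (d + 2) → Torus (d + 2)}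
    (hg : IsLift G g) : IsTransitive g := by
  have hgc : Continuous g := by
    rw [isOpenQuotientMap_toTorus.isQuotientMap.continuous_iff,
      show g ∘ toTorus = toTorus ∘ G from funext fun x => (hg x).symm]
    exact continuous_toTorus.comp hG.smooth.continuous
  refine isTransitive_of_forall_exists hgc fun U V hU hUne hV hVne => ?_
  obtain ⟨y, hy⟩ := hVne
  obtain ⟨x, hx, m, hm⟩ := hG.exists_iterate_eq (hU.preimage continuous_toTorus)
    (hUne.preimage toTorus_surjective) y
  exact ⟨toTorus x, hx, m, by rwa [← iterate_toTorus hg, hm]⟩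

end Dynamics

/-! ### The determinant as a smooth function. -/

section Determinant

variable {n : ℕ}

lemma det_eq_matrix_det (L : Vec n →L[ℝ] Vec n) :
    L.det = (Matrix.of fun i j => L (EuclideanSpace.single j 1) i).det := by
  rw [ContinuousLinearMap.det, ← LinearMap.det_toMatrix (EuclideanSpace.basisFun (Fin n) ℝ).toBasis]
  congr 1

lemma contDiff_det {k : WithTop ℕ∞} :
    ContDiff ℝ k (ContinuousLinearMap.det : (Vec n →L[ℝ] Vec n) → ℝ) := by
  have h : (ContinuousLinearMap.det : (Vec n →L[ℝ] Vec n) → ℝ) = fun L =>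
      ∑ σ : Equiv.Perm (Fin n), Equiv.Perm.sign σ •
        ∏ i, L (EuclideanSpace.single i 1) (σ i) := by
    funext L
    rw [det_eq_matrix_det, Matrix.det_apply]
    rfl
  rw [h]
  refine ContDiff.sum fun σ _ => ContDiff.const_smul _ (contDiff_prod fun i _ => ?_)
  exact ((EuclideanSpace.proj (σ i) : Vec n →L[ℝ] ℝ).comp
    (ContinuousLinearMap.apply ℝ (Vec n) (EuclideanSpace.single i (1 : ℝ)))).contDiff

lemma hasFDerivAt_det_fderiv {G : Vec n → Vec n} (hG : ContDiff ℝ 2 G) (x : Vec n) :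
    HasFDerivAt (fun y => (fderiv ℝ G y).det)
      ((fderiv ℝ ContinuousLinearMap.det (fderiv ℝ G x)).comp (fderiv ℝ (fderiv ℝ G) x)) x := by
  have h1 : ContDiff ℝ 1 (fderiv ℝ G) := hG.fderiv_right (by norm_num)
  exact ((contDiff_det (k := 1)).differentiable one_ne_zero _).hasFDerivAt.comp x
    (h1.differentiable one_ne_zero x).hasFDerivAt

/-- Only the last row of the diagonal matrix is altered, so the matrix is lower triangular. -/
lemma det_stretch_sub_smulRight {d : ℕ} (ℓ : Vec (d + 2) →L[ℝ] ℝ) :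
    (stretch (d + 1) - ℓ.smulRight (EuclideanSpace.single (Fin.last (d + 1)) (1 : ℝ))).det =
      8 * 2 ^ d * (2 - ℓ (EuclideanSpace.single (Fin.last (d + 1)) 1)) := by
  rw [det_eq_matrix_det, Matrix.det_of_isLowerTriangular]
  · rw [Fin.prod_univ_castSucc, Fin.prod_univ_succ]
    simp [Fin.last_eq_zero_iff, Fin.castSucc_ne_last, Fin.succ_ne_zero]
  · intro i j hij
    have hij' : i < j := hij
    have h1 : i ≠ j := hij'.ne
    have h2 : i ≠ Fin.last (d + 1) := (hij'.trans_le (Fin.le_last j)).ne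
    simp [h1, h2]

end Determinant

/-! ### Periodic functions on `ℝⁿ`. -/

section Periodic

variable {n : ℕ} {X : Type*}

/-- The integer points of `ℝⁿ`. -/
def intVec (a : Fin n → ℤ) : Vec n := WithLp.toLp 2 fun i => (a i : ℝ)

@[simp] lemma intVec_apply (a : Fin n → ℤ) (i : Fin n) : intVec a i = a i := rfl

/-- `ℤⁿ`-periodic functions. -/
def IsIntPeriodic (f : Vec n → X) : Prop := ∀ x a, f (x + intVec a) = f x

lemma exists_add_intVec_norm_le (x : Vec n) : ∃ a, ‖x + intVec a‖ ≤ n := by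
  refine ⟨fun i => - round (x i), (norm_le_sum_abs _).trans ?_⟩
  calc ∑ i, |(x + intVec fun i => - round (x i)) i| ≤ ∑ _i : Fin n, (1 : ℝ) := by
        refine Finset.sum_le_sum fun i _ => ?_
        have := abs_sub_round (x i)
        simp only [PiLp.add_apply, intVec_apply, Int.cast_neg, ← sub_eq_add_neg]
        linarith
    _ = n := by simp

lemma IsIntPeriodic.isCompact_range [TopologicalSpace X] {f : Vec n → X} (hf : IsIntPeriodic f)
    (hc : Continuous f) : IsCompact (range f) := by
  have : range f = f '' Metric.closedBall 0 n := by
    refine Subset.antisymm ?_ (image_subset_range _ _)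
    rintro _ ⟨x, rfl⟩
    obtain ⟨a, ha⟩ := exists_add_intVec_norm_le x
    exact ⟨x + intVec a, by simpa using ha, hf x a⟩
  rw [this]
  exact (isCompact_closedBall _ _).image hc

lemma isIntPeriodic_fderiv {E : Type*} [NormedAddCommGroup E] [NormedSpace ℝ E] {f : Vec n → E}
    (hf : ∀ a, ∃ c, ∀ x, f (x + intVec a) = f x + c) : IsIntPeriodic (fderiv ℝ f) := by
  intro x a
  obtain ⟨c, hc⟩ := hf a
  rw [← fderiv_comp_add_right, funext hc, fderiv_add_const]

end Periodic

/-! ### Model maps and their stability under C² perturbation. -/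

/-- The map `x ↦ (8 x₁, 2 x₂, …, 2 xₙ - Q(x))`. -/
def modelMap {d : ℕ} (Q : Vec (d + 2) → ℝ) (x : Vec (d + 2)) : Vec (d + 2) :=
  stretch (d + 1) x - Q x • EuclideanSpace.single (Fin.last (d + 1)) (1 : ℝ)

/-- The conditions on `Q` under which `modelMap Q` is robustly transitive. -/
structure IsModel {d : ℕ} (Q : Vec (d + 2) → ℝ) : Prop where
  smooth : ContDiff ℝ 2 Q
  periodic : IsIntPeriodic Q
  partial_bound : ∀ x, |2 - fderiv ℝ Q x (EuclideanSpace.single (Fin.last (d + 1)) 1)| ≤ 5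
  nondegenerate : ∀ x, fderiv ℝ Q x (EuclideanSpace.single (Fin.last (d + 1)) 1) = 2 →
    fderiv ℝ (fun y => fderiv ℝ Q y (EuclideanSpace.single (Fin.last (d + 1)) 1)) x ≠ 0
  small : ∀ (N : ℤ) (x : Vec (d + 2)), x 0 ∈ Icc (N + 2 / 5 : ℝ) (N + 3 / 5) → |Q x| ≤ 1 / 200
  lipschitz : ∀ (N : ℤ) (x y : Vec (d + 2)), x 0 ∈ Icc (N + 2 / 5 : ℝ) (N + 3 / 5) →
    y 0 ∈ Icc (N + 2 / 5 : ℝ) (N + 3 / 5) → |Q x - Q y| ≤ 1 / 20 * ‖x - y‖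

section Model

variable {d : ℕ} {Q : Vec (d + 2) → ℝ}

lemma IsModel.contDiff_modelMap (hQ : IsModel Q) : ContDiff ℝ 2 (modelMap Q) :=
  (stretch (d + 1)).contDiff.sub (hQ.smooth.smul contDiff_const)

lemma IsModel.hasFDerivAt_modelMap (hQ : IsModel Q) (x : Vec (d + 2)) :
    HasFDerivAt (modelMap Q) (stretch (d + 1) -
      (fderiv ℝ Q x).smulRight (EuclideanSpace.single (Fin.last (d + 1)) (1 : ℝ))) x :=
  (stretch (d + 1)).hasFDerivAt.sub
    ((hQ.smooth.differentiable two_ne_zero x).hasFDerivAt.smul_const _)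

lemma IsModel.modelMap_add_intVec (hQ : IsModel Q) (a : Fin (d + 2) → ℤ) (x : Vec (d + 2)) :
    modelMap Q (x + intVec a) = modelMap Q x + stretch (d + 1) (intVec a) := by
  simp only [modelMap, hQ.periodic x a, map_add]
  abel

/-- Periodicity makes the range of `(f, h)` compact, so it has positive distance from a closed set
that it avoids. -/
lemma exists_forall_norm_sub_lt_not {n : ℕ} {E F : Type*} [NormedAddCommGroup E]
    [NormedAddCommGroup F] {f : Vec n → E} {h : Vec n → F} (hf : IsIntPeriodic f)
    (hh : IsIntPeriodic h) (hfc : Continuous f) (hhc : Continuous h) {P : E → F → Prop}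
    (hP : IsClosed {p : E × F | P p.1 p.2}) (hn : ∀ x, ¬ P (f x) (h x)) :
    ∃ ε : ℝ, 0 < ε ∧ ∀ x a b, ‖a - f x‖ < ε → ‖b - h x‖ < ε → ¬ P a b := by
  have hp : IsIntPeriodic fun x => (f x, h x) := fun x a => Prod.ext (hf x a) (hh x a)
  obtain ⟨ε, hε, hth⟩ := (hp.isCompact_range (hfc.prodMk hhc)).exists_thickening_subset_open
    hP.isOpen_compl (range_subset_iff.2 hn)
  refine ⟨ε, hε, fun x a b ha hb => ?_⟩
  have hmem : (a, b) ∈ {p : E × F | P p.1 p.2}ᶜ := by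
    refine hth (Metric.mem_thickening_iff.2 ⟨(f x, h x), ⟨x, rfl⟩, ?_⟩)
    rw [dist_eq_norm]
    exact max_lt ha hb
  exact hmem

/-- The 1-jets `(L, B)` of maps `x ↦ D_x G` at which `det D_x G` vanishes to second order. -/
def IsDegenerateJet {n : ℕ} (L : Vec n →L[ℝ] Vec n) (B : Vec n →L[ℝ] Vec n →L[ℝ] Vec n) : Prop :=
  L.det = 0 ∧ (fderiv ℝ ContinuousLinearMap.det L).comp B = 0

lemma isClosed_isDegenerateJet {n : ℕ} :
    IsClosed {p : (Vec n →L[ℝ] Vec n) × (Vec n →L[ℝ] Vec n →L[ℝ] Vec n) |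
      IsDegenerateJet p.1 p.2} := by
  have h1 : Continuous fun p : (Vec n →L[ℝ] Vec n) × (Vec n →L[ℝ] Vec n →L[ℝ] Vec n) =>
      p.1.det := (contDiff_det (k := 1)).continuous.comp continuous_fst
  have h2 : Continuous fun p : (Vec n →L[ℝ] Vec n) × (Vec n →L[ℝ] Vec n →L[ℝ] Vec n) =>
      (fderiv ℝ ContinuousLinearMap.det p.1).comp p.2 :=
    (((contDiff_det (k := 1)).continuous_fderiv one_ne_zero).comp continuous_fst).clm_comp
      continuous_snd
  exact (isClosed_eq h1 continuous_const).inter (isClosed_eq h2 continuous_const)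

lemma isDegenerateJet_iff {n : ℕ} {G : Vec n → Vec n} (hG : ContDiff ℝ 2 G) (x : Vec n) :
    IsDegenerateJet (fderiv ℝ G x) (fderiv ℝ (fderiv ℝ G) x) ↔
      (fderiv ℝ G x).det = 0 ∧ fderiv ℝ (fun y => (fderiv ℝ G y).det) x = 0 := by
  rw [(hasFDerivAt_det_fderiv hG x).fderiv, IsDegenerateJet]

lemma IsModel.not_isDegenerateJet (hQ : IsModel Q) (x : Vec (d + 2)) :
    ¬ IsDegenerateJet (fderiv ℝ (modelMap Q) x) (fderiv ℝ (fderiv ℝ (modelMap Q)) x) := by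
  rw [isDegenerateJet_iff hQ.contDiff_modelMap]
  rintro ⟨h1, h2⟩
  have h3 : ∀ y, (fderiv ℝ (modelMap Q) y).det = 8 * 2 ^ d *
      (2 - fderiv ℝ Q y (EuclideanSpace.single (Fin.last (d + 1)) 1)) := fun y => by
    rw [(hQ.hasFDerivAt_modelMap y).fderiv, det_stretch_sub_smulRight]
  have h5 : DifferentiableAt ℝ
      (fun y => fderiv ℝ Q y (EuclideanSpace.single (Fin.last (d + 1)) 1)) x :=
    ((hQ.smooth.fderiv_right (m := 1) (by norm_num)).clm_apply contDiff_const).differentiable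
      one_ne_zero x
  have hc : (8 * 2 ^ d : ℝ) ≠ 0 := by positivity
  refine hQ.nondegenerate x ?_ ?_
  · rw [h3] at h1
    linarith [(mul_eq_zero.1 h1).resolve_left hc]
  · rw [funext h3, fderiv_const_mul (h5.const_sub 2), fderiv_const_sub] at h2
    exact neg_eq_zero.1 ((smul_eq_zero.1 h2).resolve_left hc)

/-- The second order jets of the model map stay away from the degenerate ones. -/
lemma IsModel.exists_nondegenerate (hQ : IsModel Q) : ∃ ε > 0, ∀ G : Vec (d + 2) → Vec (d + 2),
    ContDiff ℝ 2 G → (∀ x, ‖fderiv ℝ G x - fderiv ℝ (modelMap Q) x‖ < ε) →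
    (∀ x, ‖fderiv ℝ (fderiv ℝ G) x - fderiv ℝ (fderiv ℝ (modelMap Q)) x‖ < ε) →
    ∀ x, (fderiv ℝ G x).det = 0 → fderiv ℝ (fun y => (fderiv ℝ G y).det) x ≠ 0 := by
  have hH1 : ContDiff ℝ 1 (fderiv ℝ (modelMap Q)) :=
    hQ.contDiff_modelMap.fderiv_right (by norm_num)
  have hp1 : IsIntPeriodic (fderiv ℝ (modelMap Q)) :=
    isIntPeriodic_fderiv fun a => ⟨_, hQ.modelMap_add_intVec a⟩
  have hp2 : IsIntPeriodic (fderiv ℝ (fderiv ℝ (modelMap Q))) :=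
    isIntPeriodic_fderiv fun a => ⟨0, fun x => by rw [hp1 x a, add_zero]⟩
  have hcl : IsClosed {p : (Vec (d + 2) →L[ℝ] Vec (d + 2)) ×
      (Vec (d + 2) →L[ℝ] Vec (d + 2) →L[ℝ] Vec (d + 2)) | IsDegenerateJet p.1 p.2} :=
    isClosed_isDegenerateJet
  have h3 := exists_forall_norm_sub_lt_not hp1 hp2 hH1.continuous
    (hH1.continuous_fderiv one_ne_zero) hcl hQ.not_isDegenerateJet
  obtain ⟨ε, hε, hth⟩ := h3
  refine ⟨ε, hε, fun G hG h1 h2 x hx h0 => ?_⟩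
  have := hth x _ _ (h1 x) (h2 x)
  rw [isDegenerateJet_iff hG x] at this
  exact this ⟨hx, h0⟩

/-- The last row of the derivative may have large off-diagonal entries, so the last coordinate gets
a small weight `κ`. The weighted system is dominated by the factor 8 in the first coordinate. -/
lemma IsModel.exists_cone (hQ : IsModel Q) : ∃ ε > 0, ∃ κ : ℝ, 0 < κ ∧
    ∀ (x : Vec (d + 2)) (L : Vec (d + 2) →L[ℝ] Vec (d + 2)), ‖L - fderiv ℝ (modelMap Q) x‖ ≤ ε →
      ∀ v, InCone κ v → InCone κ (L v) ∧ 7 * v 0 ≤ L v 0 := by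
  obtain ⟨C, hC⟩ := (IsIntPeriodic.isCompact_range (isIntPeriodic_fderiv fun a =>
    ⟨0, fun x => by rw [hQ.periodic x a, add_zero]⟩)
    (hQ.smooth.continuous_fderiv two_ne_zero)).isBounded.exists_norm_le
  have hC' : ∀ x, ‖fderiv ℝ Q x‖ ≤ C := fun x => hC _ ⟨x, rfl⟩
  have hC0 : 0 ≤ C := (norm_nonneg _).trans (hC' 0)
  -- `C * (d + 1)` controls the effect of the first `n - 1` coordinates on the last; `κ` reduces it
  -- to at most `v 0`.
  set κ : ℝ := 1 / (C * (d + 1) + 1) with hκ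
  have hκ0 : 0 < κ := by positivity
  have hκ1 : κ ≤ 1 := by
    rw [hκ, div_le_one (by positivity)]
    have : 0 ≤ C * (d + 1) := by positivity
    linarith
  have hκC : κ * (C * (d + 1)) ≤ 1 := by
    rw [hκ, one_div_mul_eq_div, div_le_one (by positivity)]
    linarith
  -- On the cone `‖v‖ ≤ (d + 1 + 1/κ) v₀`, so the perturbation moves each coordinate of the image by
  -- at most `v₀ / 2`.
  refine ⟨1 / (2 * (d + 1 + 1 / κ)), by positivity, κ, hκ0, fun x L hL v hv => ?_⟩
  set ε := 1 / (2 * (d + 1 + 1 / κ)) with hε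
  set e := EuclideanSpace.single (Fin.last (d + 1)) (1 : ℝ) with he
  set D := L - fderiv ℝ (modelMap Q) x with hD
  have hv0 : 0 ≤ v 0 := (abs_nonneg _).trans (hv.1 0)
  have hvl : |v (Fin.last (d + 1))| ≤ 1 / κ * v 0 := by
    rw [one_div_mul_eq_div, le_div_iff₀ hκ0, mul_comm]; exact hv.2
  have hvn : ‖v‖ ≤ (d + 1 + 1 / κ) * v 0 := by
    refine (norm_le_sum_abs v).trans ?_
    rw [Fin.sum_univ_castSucc]
    have : ∑ k : Fin (d + 1), |v k.castSucc| ≤ ∑ _k : Fin (d + 1), v 0 :=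
      Finset.sum_le_sum fun k _ => hv.1 k
    simp only [Finset.sum_const, Finset.card_univ, Fintype.card_fin, nsmul_eq_mul] at this
    push_cast at this
    linarith
  have hDv : ∀ i, |D v i| ≤ v 0 / 2 := by
    intro i
    refine (abs_apply_le_norm _ i).trans ((D.le_opNorm v).trans ?_)
    calc ‖D‖ * ‖v‖ ≤ ε * ((d + 1 + 1 / κ) * v 0) := by gcongr
      _ = v 0 / 2 := by rw [hε]; field_simp
  have hLv : ∀ i, L v i = (if i = 0 then 8 else 2) * v i - fderiv ℝ Q x v * e i + D v i := by
    intro i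
    have : L v = fderiv ℝ (modelMap Q) x v + D v := by rw [hD]; simp
    rw [this, (hQ.hasFDerivAt_modelMap x).fderiv]
    simp [he]
  have he' : ∀ k : Fin (d + 1), e k.castSucc = 0 := fun k => by
    simp [he, (Fin.castSucc_lt_last k).ne]
  have hL0 : 7 * v 0 ≤ L v 0 := by
    have h1 := hLv 0
    have h2 := he' 0
    rw [Fin.castSucc_zero] at h2
    rw [h2, if_pos rfl] at h1
    linarith [(abs_le.1 (hDv 0)).1]
  refine ⟨⟨fun k => ?_, ?_⟩, hL0⟩
  · by_cases hk : k = 0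
    · subst hk
      rw [Fin.castSucc_zero, abs_of_nonneg (by linarith)]
    · have h1 := hLv k.castSucc
      rw [he' k, if_neg (by simpa [Fin.castSucc_eq_zero_iff] using hk)] at h1
      have h2 := abs_le.1 (hv.1 k)
      have h3 := abs_le.1 (hDv k.castSucc)
      refine le_trans ?_ hL0
      rw [abs_le]
      constructor <;> linarith [h2.1, h2.2, h3.1, h3.2]
  · set l := Fin.last (d + 1) with hl
    have h1 := hLv l
    have h2 : e l = 1 := by simp [he]
    rw [h2, if_neg (by simp [hl, Fin.last_eq_zero_iff]), mul_one] at h1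
    set w := v - v l • e with hw
    have h3 : fderiv ℝ Q x v = v l * fderiv ℝ Q x e + fderiv ℝ Q x w := by
      rw [hw, map_sub, map_smul, smul_eq_mul]; ring
    have h4 : ‖w‖ ≤ (d + 1) * v 0 := by
      refine (norm_le_sum_abs w).trans ?_
      rw [Fin.sum_univ_castSucc]
      have h5 : ∑ k : Fin (d + 1), |w k.castSucc| ≤ ∑ _k : Fin (d + 1), v 0 :=
        Finset.sum_le_sum fun k _ => by simpa [hw, he' k] using hv.1 k
      have h6 : w (Fin.last (d + 1)) = 0 := by simp [hw, ← hl, h2]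
      rw [h6]
      simp only [Finset.sum_const, Finset.card_univ, Fintype.card_fin, nsmul_eq_mul] at h5
      push_cast at h5
      simpa using h5
    have h5 : |fderiv ℝ Q x w| ≤ C * ((d + 1) * v 0) := by
      refine ((fderiv ℝ Q x).le_opNorm w).trans ?_
      gcongr
      exact hC' x
    have h6 : L v l = (2 - fderiv ℝ Q x e) * v l - fderiv ℝ Q x w + D v l := by
      rw [h1, h3]; ring
    have h7 : |L v l| ≤ 5 * |v l| + C * ((d + 1) * v 0) + v 0 / 2 := by
      rw [h6]
      refine (abs_add_le _ _).trans (add_le_add ((abs_sub _ _).trans (add_le_add ?_ h5)) (hDv l))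
      rw [abs_mul]
      gcongr
      exact hQ.partial_bound x
    have h8 : κ * |L v l| ≤ 5 * (κ * |v l|) + κ * (C * (d + 1)) * v 0 + κ * v 0 / 2 := by
      calc κ * |L v l| ≤ κ * (5 * |v l| + C * ((d + 1) * v 0) + v 0 / 2) := by gcongr
        _ = _ := by ring
    have h9 : κ * (C * (d + 1)) * v 0 ≤ 1 * v 0 := by gcongr
    have h10 : κ * v 0 ≤ 1 * v 0 := by gcongr
    -- The weighted last coordinate is at most `(5 + 1 + 1/2) v₀`, less than the `7 v₀` gained by
    -- the first.
    linarith [hv.2]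

theorem IsModel.exists_isExpandingLift (hQ : IsModel Q) : ∃ ε > 0,
    ∀ G : Vec (d + 2) → Vec (d + 2), ContDiff ℝ 2 G →
      (∀ i ≤ 2, ∀ x, ‖iteratedFDeriv ℝ i (fun y => G y - modelMap Q y) x‖ < ε) →
      IsExpandingLift G := by
  obtain ⟨ε₁, hε₁, hnd⟩ := hQ.exists_nondegenerate
  obtain ⟨ε₂, hε₂, κ, hκ, hcone⟩ := hQ.exists_cone
  refine ⟨min (1 / 200) (min ε₁ ε₂), by positivity, fun G hG hclose => ?_⟩
  set ε := min (1 / 200) (min ε₁ ε₂) with hε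
  have hεa : ε ≤ 1 / 200 := min_le_left _ _
  have hεb : ε ≤ ε₁ := (min_le_right _ _).trans (min_le_left _ _)
  have hεc : ε ≤ ε₂ := (min_le_right _ _).trans (min_le_right _ _)
  have hH := hQ.contDiff_modelMap
  set R : Vec (d + 2) → Vec (d + 2) := fun y => G y - modelMap Q y with hR
  have hRc : ContDiff ℝ 2 R := hG.sub hH
  have h0 : ∀ x, ‖R x‖ < ε := fun x => by
    simpa only [norm_iteratedFDeriv_zero] using hclose 0 (by norm_num) x
  have h1 : ∀ x, ‖fderiv ℝ R x‖ < ε := fun x => by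
    simpa only [norm_iteratedFDeriv_one] using hclose 1 (by norm_num) x
  have h2 : ∀ x, ‖fderiv ℝ (fderiv ℝ R) x‖ < ε := fun x => by
    have := hclose 2 le_rfl x
    rwa [← norm_iteratedFDeriv_fderiv (n := 1), norm_iteratedFDeriv_one] at this
  have hfd : fderiv ℝ R = fun x => fderiv ℝ G x - fderiv ℝ (modelMap Q) x := by
    funext x
    exact fderiv_fun_sub (hG.differentiable two_ne_zero x) (hH.differentiable two_ne_zero x)
  have hfd2 : ∀ x, fderiv ℝ (fderiv ℝ R) x =
      fderiv ℝ (fderiv ℝ G) x - fderiv ℝ (fderiv ℝ (modelMap Q)) x := by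
    intro x
    rw [hfd]
    exact fderiv_fun_sub
      ((hG.fderiv_right (m := 1) (by norm_num)).differentiable one_ne_zero x)
      ((hH.fderiv_right (m := 1) (by norm_num)).differentiable one_ne_zero x)
  have hlast : (EuclideanSpace.single (Fin.last (d + 1)) (1 : ℝ) : Vec (d + 2)) 0 = 0 := by
    simp
  have hGR : ∀ x, G x = stretch (d + 1) x -
      Q x • EuclideanSpace.single (Fin.last (d + 1)) (1 : ℝ) + R x := by
    intro x
    simp only [hR, modelMap]
    abel
  refine ⟨hG, (contDiff_det (k := 1)).comp (hG.fderiv_right (by norm_num)),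
    hnd G hG ?_ ?_, ?_, ⟨κ, hκ, fun x v hv => ?_⟩, ?_, ?_⟩
  · intro x
    have := h1 x
    rw [hfd] at this
    exact this.trans_le hεb
  · intro x
    rw [← hfd2]
    exact (h2 x).trans_le hεb
  · intro x
    have h3 := (abs_apply_le_norm (R x) 0).trans (h0 x).le
    have h4 : G x 0 - 8 * x 0 = R x 0 := by
      rw [hGR x]
      simp only [PiLp.add_apply, PiLp.sub_apply, PiLp.smul_apply, hlast, stretch_apply, if_true,
        smul_zero]
      ring
    rw [h4]
    linarith
  · refine hcone x _ ?_ v hv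
    have := h1 x
    rw [hfd] at this
    exact this.le.trans hεc
  · intro N x hx
    have h3 : G x - stretch (d + 1) x =
        R x - Q x • EuclideanSpace.single (Fin.last (d + 1)) (1 : ℝ) := by
      rw [hGR x]; abel
    rw [h3]
    refine (norm_sub_le _ _).trans ?_
    rw [norm_smul, PiLp.norm_single, Real.norm_eq_abs, norm_one, mul_one]
    linarith [h0 x, hQ.small N x hx]
  · intro N x y hx hy
    have h3 : G x - G y - stretch (d + 1) (x - y) = (R x - R y) -
        (Q x - Q y) • EuclideanSpace.single (Fin.last (d + 1)) (1 : ℝ) := by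
      rw [hGR x, hGR y, map_sub, sub_smul]; abel
    rw [h3]
    refine (norm_sub_le _ _).trans ?_
    rw [norm_smul, PiLp.norm_single, Real.norm_eq_abs, norm_one, mul_one]
    have h4 : ‖R x - R y‖ ≤ ε * ‖x - y‖ :=
      convex_univ.norm_image_sub_le_of_norm_fderiv_le
        (fun z _ => hRc.differentiable two_ne_zero z) (fun z _ => (h1 z).le) (mem_univ y)
        (mem_univ x)
    have h5 := hQ.lipschitz N x y hx hy
    have h6 : ε * ‖x - y‖ ≤ 1 / 200 * ‖x - y‖ := by gcongr
    have := norm_nonneg (x - y)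
    linarith

end Model

/-! ### Representatives in the unit cube and periodization. -/

section Representatives

variable {m : ℕ}

lemma rep_mem (c : UnitAddCircle) : rep c ∈ Ico (-1 / 2 : ℝ) (1 / 2) := by
  have := (AddCircle.equivIco (1 : ℝ) (-1 / 2) c).2
  exact ⟨this.1, this.2.trans_eq (by norm_num)⟩

lemma abs_rep_le (c : UnitAddCircle) : |rep c| ≤ 1 / 2 := by
  have := rep_mem c
  rw [abs_le]
  constructor <;> linarith [this.1, this.2]

lemma coe_rep (c : UnitAddCircle) : ((rep c : ℝ) : UnitAddCircle) = c :=
  (AddCircle.equivIco (1 : ℝ) (-1 / 2)).symm_apply_apply c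

lemma rep_coe_of_mem {t : ℝ} (ht : t ∈ Ico (-1 / 2 : ℝ) (1 / 2)) :
    rep (t : UnitAddCircle) = t := by
  have ht' : t ∈ Ico (-1 / 2 : ℝ) (-1 / 2 + 1) := ⟨ht.1, ht.2.trans_eq (by norm_num)⟩
  exact congrArg Subtype.val (AddCircle.equivIco_coe_eq ht')

lemma coe_eq_coe_iff {s t : ℝ} : (s : UnitAddCircle) = t ↔ ∃ a : ℤ, s = t + a := by
  rw [QuotientAddGroup.eq_iff_sub_mem, AddSubgroup.mem_zmultiples_iff]
  simp only [zsmul_eq_mul, mul_one]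
  exact exists_congr fun a => by rw [eq_sub_iff_add_eq, eq_comm, add_comm]

lemma exists_rep_eq (t : ℝ) : ∃ a : ℤ, rep (t : UnitAddCircle) = t + a :=
  coe_eq_coe_iff.1 (coe_rep t)

/-- The representative in the cube `[-1/2, 1/2)ᵐ` of a point of `ℝᵐ`. -/
def repVec (x : Vec m) : Vec m := WithLp.toLp 2 fun i => rep (x i : UnitAddCircle)

@[simp] lemma repVec_apply (x : Vec m) (i : Fin m) : repVec x i = rep (x i : UnitAddCircle) := rfl

lemma exists_repVec_eq (x : Vec m) : ∃ a, repVec x = x + intVec a := by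
  choose a ha using fun i => exists_rep_eq (x i)
  exact ⟨a, by ext i; exact ha i⟩

lemma coe_add_intCast (t : ℝ) (a : ℤ) : ((t + a : ℝ) : UnitAddCircle) = t :=
  coe_eq_coe_iff.2 ⟨a, rfl⟩

lemma repVec_add_intVec (x : Vec m) (a : Fin m → ℤ) : repVec (x + intVec a) = repVec x := by
  ext i
  simp only [repVec_apply, PiLp.add_apply, intVec_apply, coe_add_intCast]

lemma lt_abs_add_intCast {K t : ℝ} (h1 : K < |t|) (h2 : |t| < 1 - K) (a : ℤ) : K < |t + a| := by
  rcases eq_or_ne a 0 with rfl | ha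
  · simpa using h1
  · have h3 : (1 : ℝ) ≤ |(a : ℝ)| := by exact_mod_cast Int.one_le_abs ha
    have h4 := abs_sub (t + a) t
    rw [add_sub_cancel_left] at h4
    linarith

/-- A function that vanishes near the boundary of the cube is, after periodization, locally a
translate of itself. -/
lemma eventuallyEq_comp_repVec {X : Type*} [Zero X] {v : Vec m → X} {K : ℝ} (hK : K < 1 / 2)
    (hv : ∀ y : Vec m, ∀ k, K ≤ |y k| → v y = 0) {x : Vec m} {a : Fin m → ℤ}
    (ha : repVec x = x + intVec a) :
    (fun w => v (repVec w)) =ᶠ[𝓝 x] fun w => v (w + intVec a) := by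
  have hcont : ∀ k, Continuous fun w : Vec m => |(w + intVec a) k| := fun k => by
    have := (EuclideanSpace.proj (𝕜 := ℝ) k : Vec m →L[ℝ] ℝ).continuous
    exact (this.comp (continuous_id.add continuous_const)).abs
  have hx : ∀ k, |(x + intVec a) k| ≤ 1 / 2 := fun k => by
    rw [← ha]; exact abs_rep_le (x k)
  -- Inside the cube `repVec` is locally a translation. Where some coordinate is `±1/2`, both
  -- functions vanish nearby, because the condition `K < |t| < 1 - K` keeps all integer translates
  -- of `t` outside `[-K, K]`.
  by_cases h : ∀ k, |(x + intVec a) k| < 1 / 2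
  · have : ∀ᶠ w in 𝓝 x, ∀ k, |(w + intVec a) k| < 1 / 2 :=
      eventually_all.2 fun k => (hcont k).continuousAt.eventually (gt_mem_nhds (h k))
    filter_upwards [this] with w hw
    congr 1
    rw [← repVec_add_intVec w a]
    ext k
    have := abs_lt.1 (hw k)
    exact rep_coe_of_mem ⟨by linarith [this.1], this.2⟩
  · push Not at h
    obtain ⟨k, hk⟩ := h
    have h1 : ∀ᶠ w in 𝓝 x, K < |(w + intVec a) k| :=
      (hcont k).continuousAt.eventually (lt_mem_nhds (by linarith))
    have h2 : ∀ᶠ w in 𝓝 x, |(w + intVec a) k| < 1 - K :=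
      (hcont k).continuousAt.eventually (gt_mem_nhds (by linarith [hx k]))
    filter_upwards [h1, h2] with w h3 h4
    rw [hv _ k h3.le]
    refine hv _ k ?_
    rw [← repVec_add_intVec w a]
    obtain ⟨b, hb⟩ := exists_rep_eq ((w + intVec a) k)
    rw [repVec_apply, hb]
    exact (lt_abs_add_intCast h3 h4 b).le

section Periodization

variable {E : Type*} [NormedAddCommGroup E] [NormedSpace ℝ E] {v : Vec m → E} {K : ℝ}

lemma contDiff_comp_repVec {k : WithTop ℕ∞} (hK : K < 1 / 2)
    (hv : ∀ y : Vec m, ∀ k, K ≤ |y k| → v y = 0) (hvc : ContDiff ℝ k v) :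
    ContDiff ℝ k fun x => v (repVec x) := by
  rw [contDiff_iff_contDiffAt]
  intro x
  obtain ⟨a, ha⟩ := exists_repVec_eq x
  exact (hvc.comp (contDiff_id.add contDiff_const)).contDiffAt.congr_of_eventuallyEq
    (eventuallyEq_comp_repVec hK hv ha)

lemma fderiv_comp_repVec (hK : K < 1 / 2) (hv : ∀ y : Vec m, ∀ k, K ≤ |y k| → v y = 0)
    (x : Vec m) : fderiv ℝ (fun x => v (repVec x)) x = fderiv ℝ v (repVec x) := by
  obtain ⟨a, ha⟩ := exists_repVec_eq x
  rw [(eventuallyEq_comp_repVec hK hv ha).fderiv_eq, fderiv_comp_add_right, ha]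

end Periodization

/-- Two lifts of a torus map differ by an integer vector. -/
lemma exists_eq_add_intVec {g : Torus m → Torus m} {F G : Vec m → Vec m} (hF : IsLift F g)
    (hG : IsLift G g) (hFc : Continuous F) (hGc : Continuous G) :
    ∃ a, ∀ x, F x = G x + intVec a := by
  have h : ∀ x i, ∃ a : ℤ, F x i = G x i + a := fun x i =>
    coe_eq_coe_iff.1 (congrFun ((hF x).trans (hG x).symm) i)
  choose a ha using h
  have hc : ∀ i, Continuous fun x => a x i := by
    intro i
    rw [Int.isClosedEmbedding_coe_real.isInducing.continuous_iff]
    have : (Int.cast ∘ fun x => a x i : Vec m → ℝ) = fun x => F x i - G x i := by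
      funext x
      simp [ha x i]
    rw [this]
    exact ((EuclideanSpace.proj (𝕜 := ℝ) i).continuous.comp hFc).sub
      ((EuclideanSpace.proj (𝕜 := ℝ) i).continuous.comp hGc)
  refine ⟨a 0, fun x => ?_⟩
  ext i
  rw [ha x i, PreconnectedSpace.constant inferInstance (hc i) (x := x) (y := 0)]
  rfl

end Representatives

theorem IsModel.isRobustlyTransitive {d : ℕ} {Q : Vec (d + 2) → ℝ} (hQ : IsModel Q)
    {h : Torus (d + 2) → Torus (d + 2)} (hh : IsLift (modelMap Q) h) :
    IsRobustlyTransitive 2 h := by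
  refine ⟨⟨_, hh, hQ.contDiff_modelMap⟩, ?_⟩
  obtain ⟨ε, hε, hexp⟩ := hQ.exists_isExpandingLift
  refine ⟨ε, hε, ?_⟩
  rintro g ⟨G, F, hG, hF, hGc, hFc, hclose⟩
  -- The lift in the definition of the neighbourhood need not be `modelMap Q`; an integer
  -- translation corrects this without changing derivatives.
  obtain ⟨a, ha⟩ := exists_eq_add_intVec hF hh hFc.continuous hQ.contDiff_modelMap.continuous
  have hlift : IsLift (fun x => G x - intVec a) g := by
    intro x
    rw [← hG x, ← toTorus_add_int (G x - intVec a) a]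
    exact congrArg toTorus (sub_add_cancel _ _)
  refine (hexp _ (hGc.sub contDiff_const) fun i hi x => ?_).isTransitive hlift
  have : (fun y => G y - intVec a - modelMap Q y) = fun y => G y - F y := by
    funext y
    rw [ha y]
    abel
  rw [this]
  exact hclose i hi x

/-! ### Numerical bounds on `r`, `ψ` and `φ'`. -/

section Bounds

@[simp] lemma snocVec_castSucc {d : ℕ} (z : Vec (d + 1)) (s : ℝ) (k : Fin (d + 1)) :
    snocVec z s k.castSucc = z k := by
  simp [snocVec]

@[simp] lemma snocVec_last {d : ℕ} (z : Vec (d + 1)) (s : ℝ) :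
    snocVec z s (Fin.last (d + 1)) = s := by
  simp [snocVec]

/-- Disjointness of the ball from its image fails for an explicit pair with `A x = x'`: both points
differ from `p` by `1/36` and `1/12` in the first and last coordinates, and `√10/36 < 11/125`. -/
lemma IsAdmissibleRadius.lt {d : ℕ} {r : ℝ} (hr : IsAdmissibleRadius d r) : r < 11 / 125 := by
  by_contra! hr'
  set x : Vec (d + 2) := snocVec (EuclideanSpace.single 0 (5 / 18)) (1 / 6) with hx
  set x' : Vec (d + 2) := snocVec (EuclideanSpace.single 0 (2 / 9)) (1 / 3) with hx'
  have hball : ∀ s t : ℝ, |s - 1 / 4| ≤ 1 / 36 → |t - 1 / 4| ≤ 1 / 12 →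
      toTorus (snocVec (EuclideanSpace.single 0 s) t) ∈ torusBall (center d) r := by
    intro s t hs ht
    refine ⟨_, _, rfl, rfl, lt_of_lt_of_le ?_ hr'⟩
    rw [dist_comm, EuclideanSpace.dist_eq, Real.sqrt_lt' (by norm_num), Fin.sum_univ_castSucc]
    simp only [snocVec_castSucc, snocVec_last, centerInit]
    rw [Fin.sum_univ_succ]
    have h1 : (s - 1 / 4) ^ 2 ≤ (1 / 36) ^ 2 := sq_le_sq' (abs_le.1 hs).1 (abs_le.1 hs).2
    have h2 : (t - 1 / 4) ^ 2 ≤ (1 / 12) ^ 2 := sq_le_sq' (abs_le.1 ht).1 (abs_le.1 ht).2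
    simp [Real.dist_eq, sq_abs]
    norm_num at h1 h2 ⊢
    linarith
  have h1 : toTorus x ∈ torusBall (center d) r := by
    apply hball <;> rw [abs_le] <;> constructor <;> norm_num
  have h2 : toTorus x' ∈ torusBall (center d) r := by
    apply hball <;> rw [abs_le] <;> constructor <;> norm_num
  have h3 : linearA d (toTorus x) = toTorus x' := by
    funext i
    refine Fin.lastCases ?_ (fun k => ?_) i
    · rw [linearA, if_neg (by simp [Fin.last_eq_zero_iff])]
      simp only [toTorus, hx, hx', snocVec_last, ← AddCircle.coe_nsmul]
      norm_num
    · by_cases hk : k = 0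
      · subst hk
        rw [linearA, if_pos Fin.castSucc_zero]
        simp only [toTorus, hx, hx', snocVec_castSucc, ← AddCircle.coe_nsmul]
        exact coe_eq_coe_iff.2 ⟨2, by norm_num⟩
      · rw [linearA, if_neg (by simpa [Fin.castSucc_eq_zero_iff] using hk)]
        simp only [toTorus, hx, hx', snocVec_castSucc, ← AddCircle.coe_nsmul]
        simp [hk]
  have h4 : toTorus x' ∈ linearA d '' torusBall (center d) r ∩ closure (torusBall (center d) r) :=
    ⟨⟨_, h1, h3⟩, subset_closure h2⟩
  rw [hr.image_disjoint] at h4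
  exact h4

variable {θ δ : ℝ} {ψ φ : ℝ → ℝ}

/-- An extremum over the closed interval is attained at an endpoint, with value 0, or at the only
critical point, with value 4. -/
lemma IsPsi.mem_Icc (hψ : IsPsi θ ψ) (hθ : 0 < θ) (s : ℝ) : ψ s ∈ Icc 0 4 := by
  set I := Icc (1 / 16 - θ) (1 / 16 + θ) with hI
  have hne : I.Nonempty := ⟨1 / 16, by constructor <;> linarith⟩
  have hcont := hψ.smooth.continuous
  have hbd : ∀ t ∈ I, (∀ u ∈ I, ψ t ≤ ψ u) ∨ (∀ u ∈ I, ψ u ≤ ψ t) → ψ t = 0 ∨ ψ t = 4 := by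
    intro t ht hext
    by_cases hti : t ∈ Ioo (1 / 16 - θ) (1 / 16 + θ)
    · right
      have hn : I ∈ 𝓝 t := Icc_mem_nhds hti.1 hti.2
      have h0 : deriv ψ t = 0 := by
        rcases hext with h | h
        · exact IsLocalMin.deriv_eq_zero (mem_of_superset hn h)
        · exact IsLocalMax.deriv_eq_zero (mem_of_superset hn h)
      rw [(hψ.crit_iff t hti).1 h0, hψ.value]
    · exact Or.inl (hψ.eq_zero t hti)
  by_cases hs : s ∈ I
  · obtain ⟨t, ht, htm⟩ := isCompact_Icc.exists_isMinOn hne hcont.continuousOn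
    obtain ⟨t', ht', htm'⟩ := isCompact_Icc.exists_isMaxOn hne hcont.continuousOn
    have h1 := hbd t ht (Or.inl fun u hu => htm hu)
    have h2 := hbd t' ht' (Or.inr fun u hu => htm' hu)
    have h3 : ψ t ≤ ψ s := htm hs
    have h4 : ψ s ≤ ψ t' := htm' hs
    constructor
    · rcases h1 with h | h <;> linarith
    · rcases h2 with h | h <;> linarith
  · rw [hψ.eq_zero s fun h => hs (Ioo_subset_Icc_self h)]
    norm_num

lemma IsPhi.deriv_eq_zero (hφ : IsPhi δ φ) {s : ℝ}
    (hs : s ∉ Icc (1 / 4 - δ / 4) (1 / 4 + 3 * δ / 4)) : deriv φ s = 0 := by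
  have : φ =ᶠ[𝓝 s] fun _ => (0 : ℝ) := by
    exact mem_of_superset (isClosed_Icc.isOpen_compl.mem_nhds hs) hφ.eq_zero
  rw [this.deriv_eq, deriv_const]

lemma IsPhi.deriv_mem_Icc (hφ : IsPhi δ φ) (s : ℝ) : deriv φ s ∈ Icc (-(3 / 4)) 1 := by
  by_cases hs : s ∈ Icc (1 / 4 - δ / 4) (1 / 4 + 3 * δ / 4)
  · exact hφ.deriv_mem s hs
  · rw [hφ.deriv_eq_zero hs]
    norm_num

end Bounds

/-! ### The profile `φ(xₙ) ψ(‖x̃‖²)` and its nondegeneracy. -/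

section Profile

variable {d : ℕ}

/-- The first `n - 1` coordinates of a point of `ℝⁿ`. -/
def initVec (d : ℕ) : Vec (d + 2) →L[ℝ] Vec (d + 1) :=
  LinearMap.toContinuousLinearMap
    { toFun := fun x => WithLp.toLp 2 fun k => x k.castSucc
      map_add' := fun x y => by ext i; simp
      map_smul' := fun c x => by ext i; simp }

@[simp] lemma initVec_apply (x : Vec (d + 2)) (k : Fin (d + 1)) :
    initVec d x k = x k.castSucc := rfl

@[simp] lemma initVec_single_last (c : ℝ) :
    initVec d (EuclideanSpace.single (Fin.last (d + 1)) c) = 0 := by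
  ext k
  simp [(Fin.castSucc_lt_last k).ne]

lemma norm_initVec_le (x : Vec (d + 2)) : ‖initVec d x‖ ≤ ‖x‖ := by
  rw [EuclideanSpace.norm_eq, EuclideanSpace.norm_eq]
  apply Real.sqrt_le_sqrt
  rw [Fin.sum_univ_castSucc (n := d + 1)]
  simp only [initVec_apply]
  linarith [sq_nonneg ‖x (Fin.last (d + 1))‖]

/-- The function `(x̃, xₙ) ↦ φ(xₙ) ψ(‖x̃‖²)`. -/
def profile (φ ψ : ℝ → ℝ) (x : Vec (d + 2)) : ℝ :=
  φ (x (Fin.last (d + 1))) * ψ (‖initVec d x‖ ^ 2)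

lemma contDiff_profile {φ ψ : ℝ → ℝ} {k : WithTop ℕ∞} (hφ : ContDiff ℝ k φ) (hψ : ContDiff ℝ k ψ) :
    ContDiff ℝ k (profile (d := d) φ ψ) :=
  (hφ.comp (EuclideanSpace.proj (𝕜 := ℝ) (Fin.last (d + 1)) : Vec (d + 2) →L[ℝ] ℝ).contDiff).mul
    (hψ.comp ((initVec d).contDiff.norm_sq ℝ))

lemma hasFDerivAt_profile {φ ψ : ℝ → ℝ} (hφ : Differentiable ℝ φ) (hψ : Differentiable ℝ ψ)
    (x : Vec (d + 2)) : HasFDerivAt (profile φ ψ)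
      (φ (x (Fin.last (d + 1))) • (deriv ψ (‖initVec d x‖ ^ 2) •
          ((2 : ℕ) • (innerSL ℝ (initVec d x)).comp (initVec d))) +
        ψ (‖initVec d x‖ ^ 2) • (deriv φ (x (Fin.last (d + 1))) •
          (EuclideanSpace.proj (Fin.last (d + 1)) : Vec (d + 2) →L[ℝ] ℝ))) x := by
  have h1 : HasFDerivAt (fun x : Vec (d + 2) => φ (x (Fin.last (d + 1))))
      (deriv φ (x (Fin.last (d + 1))) •
        (EuclideanSpace.proj (Fin.last (d + 1)) : Vec (d + 2) →L[ℝ] ℝ)) x :=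
    (hφ _).hasDerivAt.comp_hasFDerivAt x
      (EuclideanSpace.proj (Fin.last (d + 1)) : Vec (d + 2) →L[ℝ] ℝ).hasFDerivAt
  have h2 : HasFDerivAt (fun x : Vec (d + 2) => ψ (‖initVec d x‖ ^ 2))
      (deriv ψ (‖initVec d x‖ ^ 2) •
        ((2 : ℕ) • (innerSL ℝ (initVec d x)).comp (initVec d))) x :=
    (hψ _).hasDerivAt.comp_hasFDerivAt x (initVec d).hasFDerivAt.norm_sq
  exact h1.mul h2

lemma fderiv_profile_last {φ ψ : ℝ → ℝ} (hφ : Differentiable ℝ φ) (hψ : Differentiable ℝ ψ)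
    (x : Vec (d + 2)) :
    fderiv ℝ (profile φ ψ) x (EuclideanSpace.single (Fin.last (d + 1)) 1) =
      profile (deriv φ) ψ x := by
  rw [(hasFDerivAt_profile hφ hψ x).fderiv]
  simp [profile, mul_comm]

/-- Differentiating in the radial direction of `x̃` isolates `ψ'` in a single formula. -/
lemma fderiv_profile_init {φ ψ : ℝ → ℝ} (hφ : Differentiable ℝ φ) (hψ : Differentiable ℝ ψ)
    (x : Vec (d + 2)) :
    fderiv ℝ (profile φ ψ) x
        (x - x (Fin.last (d + 1)) • EuclideanSpace.single (Fin.last (d + 1)) (1 : ℝ)) =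
      φ (x (Fin.last (d + 1))) * (deriv ψ (‖initVec d x‖ ^ 2) * (2 * ‖initVec d x‖ ^ 2)) := by
  rw [(hasFDerivAt_profile hφ hψ x).fderiv]
  simp

variable {θ δ : ℝ} {ψ φ : ℝ → ℝ}

/-- The support of the profile lies well inside the unit cube. -/
lemma profile_eq_zero {r : ℝ} (hr : IsAdmissibleRadius d r) (hθr : θ < r / 2) (hδθ : δ < 2 * θ)
    (hδ : 0 < δ)
    (hφ : ∀ s ∉ Icc (1 / 4 - δ / 4) (1 / 4 + 3 * δ / 4), φ s = 0)
    (hψ : ∀ s ∉ Ioo (1 / 16 - θ) (1 / 16 + θ), ψ s = 0) (y : Vec (d + 2)) (k : Fin (d + 2))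
    (hk : 2 / 5 ≤ |y k|) : profile φ ψ y = 0 := by
  -- From `r < 11/125` follow `θ < 0.044` and `δ < 0.088`: the support has `0 < xₙ < 2/5` and `‖x̃‖²
  -- < 4/25`.
  have hr' := hr.lt
  revert hk
  refine Fin.lastCases (fun hk => ?_) (fun j hk => ?_) k
  · rw [profile, hφ _ fun h => ?_, zero_mul]
    rw [abs_of_nonneg (by linarith [h.1])] at hk
    linarith [h.2]
  · rw [profile, hψ _ fun h => ?_, mul_zero]
    have h1 : (2 / 5 : ℝ) ≤ ‖initVec d y‖ := hk.trans (abs_apply_le_norm (initVec d y) j)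
    nlinarith [h.2]

/-- At a degenerate zero of `2 - φ'ψ` one has `φ'' = 0` with `φ' > 0`, so `φ' = 1` and `ψ = 2`; but
also `ψ' = 0`, which forces `ψ = 4`. -/
lemma profile_deriv_nondegenerate (hθ : 0 < θ) (hθ' : θ < 1 / 16) (hψ : IsPsi θ ψ)
    (hφ : IsPhi δ φ) (y : Vec (d + 2)) (hy : profile (deriv φ) ψ y = 2) :
    fderiv ℝ (profile (deriv φ) ψ) y ≠ 0 := by
  intro h0
  have hφ' : Differentiable ℝ (deriv φ) :=
    (contDiff_infty_iff_deriv.1 hφ.smooth).2.differentiable (by simp)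
  have hψ' : Differentiable ℝ ψ := hψ.smooth.differentiable (by simp)
  have h1 := fderiv_profile_last hφ' hψ' y
  have h2 := fderiv_profile_init hφ' hψ' y
  rw [h0] at h1 h2
  simp only [profile, zero_apply] at h1 h2 hy
  set s := y (Fin.last (d + 1)) with hs
  set ρ := ‖initVec d y‖ ^ 2 with hρ
  have hψb := hψ.mem_Icc hθ ρ
  have hψ0 : ψ ρ ≠ 0 := by rintro h; simp [h] at hy
  have hψpos : 0 < ψ ρ := lt_of_le_of_ne hψb.1 hψ0.symm
  have hφpos : 0 < deriv φ s := by
    by_contra! h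
    nlinarith
  have hρI : ρ ∈ Ioo (1 / 16 - θ) (1 / 16 + θ) := by
    by_contra h
    exact hψ0 (hψ.eq_zero ρ h)
  have h3 : iteratedDeriv 2 φ s = 0 := by
    rw [iteratedDeriv_succ, iteratedDeriv_one]
    exact (mul_eq_zero.1 h1.symm).resolve_right hψ0
  have h4 := hφ.unimodal s h3 hφpos
  have h5 : ψ ρ = 2 := by
    rw [h4, hφ.deriv_max, one_mul] at hy
    exact hy
  have h6 : deriv ψ ρ = 0 := by
    have h7 := (mul_eq_zero.1 h2.symm).resolve_left hφpos.ne'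
    refine (mul_eq_zero.1 h7).resolve_right ?_
    have := hρI.1
    linarith
  have h7 := (hψ.crit_iff ρ hρI).1 h6
  rw [h7, hψ.value] at h5
  norm_num at h5

end Profile

lemma two_le_infty : (2 : WithTop ℕ∞) ≤ ∞ :=
  WithTop.coe_le_coe.2 (le_top : (2 : ℕ∞) ≤ ⊤)

/-! ### The deviation introduced by the flattening map is C¹-small. -/

section Cut

variable {m : ℕ} {Φ : Vec m → ℝ} {W : Set (Vec m)} {ε' b l : ℝ} {η : ℝ → ℝ}

/-- The deviation `η(‖z‖) (Φ(z) - 1/2)` of `cutGraph η Φ` from `1/2`. -/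
def cutDev (η : ℝ → ℝ) (Φ : Vec m → ℝ) (z : Vec m) : ℝ := η ‖z‖ * (Φ z - 1 / 2)

lemma cutDev_eq_zero (hη : IsCutoff l η) {z : Vec m} (hz : 2 * l ≤ ‖z‖) : cutDev η Φ z = 0 := by
  rw [cutDev, hη.eq_zero _ (by rwa [abs_norm]), zero_mul]

lemma cutDev_eventuallyEq_zero (hη : IsCutoff l η) {z : Vec m} (hz : 2 * l < ‖z‖) :
    cutDev η Φ =ᶠ[𝓝 z] fun _ => (0 : ℝ) := by
  filter_upwards [continuous_norm.continuousAt.eventually (lt_mem_nhds hz)] with w hw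
    using cutDev_eq_zero hη hw.le

lemma cutDev_eventuallyEq (hη : IsCutoff l η) {z : Vec m} (hz : ‖z‖ < l) :
    cutDev η Φ =ᶠ[𝓝 z] fun w => Φ w - 1 / 2 := by
  filter_upwards [continuous_norm.continuousAt.eventually (gt_mem_nhds hz)] with w hw
  rw [cutDev, hη.eq_one _ (by rwa [abs_norm]), one_mul]

lemma contDiff_cutDev (hΦ : ContDiffOn ℝ 2 Φ W) (hW : IsOpen W)
    (hb : Metric.closedBall (0 : Vec m) (2 * b) ⊆ W) (hl : 0 < l) (hlb : l < b)
    (hη : IsCutoff l η) : ContDiff ℝ 2 (cutDev η Φ) := by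
  rw [contDiff_iff_contDiffAt]
  intro z
  rcases lt_or_ge (2 * l) ‖z‖ with hz | hz
  · exact contDiffAt_const.congr_of_eventuallyEq (cutDev_eventuallyEq_zero hη hz)
  · have hzW : z ∈ W := hb (by rw [mem_closedBall_zero_iff]; linarith)
    have hΦz : ContDiffAt ℝ 2 (fun w => Φ w - 1 / 2) z :=
      (hΦ.contDiffAt (hW.mem_nhds hzW)).sub contDiffAt_const
    rcases lt_or_ge ‖z‖ l with hz' | hz'
    · exact hΦz.congr_of_eventuallyEq (cutDev_eventuallyEq hη hz')
    · have hz0 : z ≠ 0 := norm_pos_iff.1 (hl.trans_le hz')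
      exact ((hη.smooth.of_le two_le_infty).contDiffAt.comp z
        (contDiffAt_norm ℝ hz0)).mul hΦz

lemma abs_cutDev_le (hΦ : IsFlatOn Φ ε' W) (hε : 0 < ε')
    (hb : Metric.closedBall (0 : Vec m) (2 * b) ⊆ W) (hlb : l < b) (hη : IsCutoff l η)
    (z : Vec m) : |cutDev η Φ z| ≤ ε' := by
  rcases le_or_gt (2 * l) ‖z‖ with hz | hz
  · rw [cutDev_eq_zero hη hz, abs_zero]
    exact hε.le
  · have hzW : z ∈ W := hb (by rw [mem_closedBall_zero_iff]; linarith)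
    rw [cutDev, abs_mul, ← one_mul ε']
    exact mul_le_mul (hη.abs_le _) (hΦ.abs_lt z hzW).le (abs_nonneg _) zero_le_one

lemma norm_le_of_abs_apply_single_le {L : Vec m →L[ℝ] ℝ} {c : ℝ} (hc : 0 ≤ c)
    (h : ∀ k, |L (EuclideanSpace.single k 1)| ≤ c) : ‖L‖ ≤ m * c := by
  refine L.opNorm_le_bound (by positivity) fun v => ?_
  have hv : v = ∑ i, v i • EuclideanSpace.single i (1 : ℝ) := by
    ext j
    simp [Finset.sum_apply, Pi.single_apply]
  calc ‖L v‖ = ‖∑ i, v i * L (EuclideanSpace.single i 1)‖ := by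
        conv_lhs => rw [hv]
        simp
    _ ≤ ∑ i, ‖v i * L (EuclideanSpace.single i 1)‖ := norm_sum_le _ _
    _ ≤ ∑ _i : Fin m, ‖v‖ * c := by
        refine Finset.sum_le_sum fun i _ => ?_
        rw [norm_mul]
        exact mul_le_mul (abs_apply_le_norm v i) (h i) (norm_nonneg _) (norm_nonneg _)
    _ = m * c * ‖v‖ := by simp; ring

lemma norm_fderiv_cutDev_le (hΦ : IsFlatOn Φ ε' W) (hΦd : ContDiffOn ℝ 2 Φ W) (hε : 0 < ε')
    (hb : Metric.closedBall (0 : Vec m) (2 * b) ⊆ W) (hb4 : b < 1 / 4) (hl : 0 < l) (hlb : l < b)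
    (hη : IsCutoff l η) (z : Vec m) : ‖fderiv ℝ (cutDev η Φ) z‖ ≤ (m + 2) * ε' := by
  rcases lt_or_ge (2 * l) ‖z‖ with hz | hz
  · rw [(cutDev_eventuallyEq_zero hη hz).fderiv_eq, fderiv_const_apply, norm_zero]
    positivity
  · have hzW : z ∈ W := hb (by rw [mem_closedBall_zero_iff]; linarith)
    have hΦz : HasFDerivAt Φ (fderiv ℝ Φ z) z :=
      ((hΦd.contDiffAt (hΦ.isOpen.mem_nhds hzW)).differentiableAt two_ne_zero).hasFDerivAt
    have hD : ‖fderiv ℝ Φ z‖ ≤ m * ε' :=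
      norm_le_of_abs_apply_single_le hε.le fun k => (hΦ.partial_lt z hzW k).le
    rcases lt_or_ge ‖z‖ l with hz' | hz'
    · rw [(cutDev_eventuallyEq hη hz').fderiv_eq, fderiv_sub_const]
      linarith
    · have hz0 : z ≠ 0 := norm_pos_iff.1 (hl.trans_le hz')
      have hn : HasFDerivAt (fun w : Vec m => ‖w‖) (fderiv ℝ (fun w : Vec m => ‖w‖) z) z :=
        ((contDiffAt_norm (n := 1) ℝ hz0).differentiableAt one_ne_zero).hasFDerivAt
      have hn1 : ‖fderiv ℝ (fun w : Vec m => ‖w‖) z‖ ≤ 1 := by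
        simpa using norm_fderiv_le_of_lipschitz ℝ (x₀ := z) (lipschitzWith_one_norm (E := Vec m))
      have hη1 : HasDerivAt η (deriv η ‖z‖) ‖z‖ :=
        (hη.smooth.differentiable (by simp) _).hasDerivAt
      have h1 : HasFDerivAt (fun w : Vec m => η ‖w‖)
          (deriv η ‖z‖ • fderiv ℝ (fun w : Vec m => ‖w‖) z) z := hη1.comp_hasFDerivAt z hn
      have h2 : HasFDerivAt (cutDev η Φ) _ z := h1.mul (hΦz.sub_const (1 / 2))
      rw [h2.fderiv]
      refine (norm_add_le _ _).trans ?_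
      have h3 : ‖η ‖z‖ • fderiv ℝ Φ z‖ ≤ 1 * (m * ε') := by
        rw [norm_smul]
        exact mul_le_mul (hη.abs_le _) hD (norm_nonneg _) zero_le_one
      have h4 : ‖(Φ z - 1 / 2) • deriv η ‖z‖ • fderiv ℝ (fun w : Vec m => ‖w‖) z‖ ≤ 2 * ε' := by
        rw [norm_smul, norm_smul]
        -- The quadratic bound compensates `|η'| < 2/l`: the product is `8 l ε'`, small uniformly in
        -- `l`.
        have h5 : ‖Φ z - 1 / 2‖ ≤ ε' * (2 * l) ^ 2 :=
          (hΦ.abs_le z hzW).trans (by gcongr)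
        calc ‖Φ z - 1 / 2‖ * (‖deriv η ‖z‖‖ * ‖fderiv ℝ (fun w : Vec m => ‖w‖) z‖)
            ≤ ε' * (2 * l) ^ 2 * (2 / l * 1) :=
              mul_le_mul h5 (mul_le_mul (hη.deriv_lt _).le hn1 (norm_nonneg _) (by positivity))
                (by positivity) (by positivity)
          _ = 8 * l * ε' := by field_simp; ring
          _ ≤ 2 * ε' := by gcongr; linarith
      linarith

end Cut

lemma contDiffOn_imageGraph {d : ℕ} {φ ψ : ℝ → ℝ} {χ : Vec (d + 1) → ℝ} {U W : Set (Vec (d + 1))}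
    (hφ : ContDiff ℝ 2 φ) (hψ : ContDiff ℝ 2 ψ) (hχ : ContDiffOn ℝ 2 χ U)
    (hW : MapsTo (invBranch d) W U) : ContDiffOn ℝ 2 (imageGraph d φ ψ χ) W := by
  have h0 : ∀ k, ContDiff ℝ 2 fun z : Vec (d + 1) => invBranch d z k := by
    intro k
    have hk : ContDiff ℝ 2 fun z : Vec (d + 1) => z k :=
      (EuclideanSpace.proj (𝕜 := ℝ) k : Vec (d + 1) →L[ℝ] ℝ).contDiff
    simp only [invBranch]
    refine contDiff_const.add ?_
    split_ifs
    · exact hk.div_const _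
    · exact hk.div_const _
  have h1 : ContDiff ℝ 2 (invBranch d) := contDiff_euclidean.2 h0
  have h2 : ContDiffOn ℝ 2 (fun z => χ (invBranch d z)) W := hχ.comp h1.contDiffOn hW
  refine (contDiffOn_const.mul h2).sub ((hφ.comp_contDiffOn h2).mul ?_)
  exact (hψ.comp (ContDiff.sum fun k _ => (h0 k).pow 2)).contDiffOn

/-! ### The composite map as a model map. -/

section Assembly

variable {d : ℕ}

/-- The function `Q` for which `modelMap Q` lifts the shear of `f`. -/
def shearedProfile (φ ψ : ℝ → ℝ) (q : Vec (d + 1) → ℝ) (x : Vec (d + 2)) : ℝ :=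
  profile φ ψ (repVec x) + q (repVec (stretch d (initVec d x)))

lemma linearA_toTorus (x : Vec (d + 2)) :
    linearA d (toTorus x) = toTorus (stretch (d + 1) x) := by
  funext i
  by_cases hi : i = 0
  · simp [linearA, toTorus, hi, ← AddCircle.coe_nsmul]
  · simp [linearA, toTorus, hi, ← AddCircle.coe_nsmul]

lemma mapF_toTorus (φ ψ : ℝ → ℝ) (x : Vec (d + 2)) :
    mapF d φ ψ (toTorus x) = toTorus (modelMap (fun y => profile φ ψ (repVec y)) x) := by
  rw [mapF, linearA_toTorus]
  have h : ∑ k : Fin (d + 1), rep (toTorus x k.castSucc) ^ 2 = ‖initVec d (repVec x)‖ ^ 2 := by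
    rw [EuclideanSpace.norm_sq_eq]
    simp [toTorus]
  rw [h]
  funext i
  by_cases hi : i = Fin.last (d + 1)
  · subst hi
    simp [toTorus, modelMap, profile]
  · simp [toTorus, modelMap, hi]

lemma isLift_shearedProfile (φ ψ : ℝ → ℝ) (η : ℝ → ℝ) (Φ : Vec (d + 1) → ℝ) :
    IsLift (modelMap (shearedProfile φ ψ (cutDev η Φ)))
      (shear d (cutGraph η Φ) ∘ mapF d φ ψ) := by
  intro x
  rw [Function.comp_apply, mapF_toTorus, shear]
  set y := modelMap (fun y => profile φ ψ (repVec y)) x with hy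
  have h : (WithLp.toLp 2 fun k : Fin (d + 1) => rep (toTorus y k.castSucc) : Vec (d + 1)) =
      repVec (stretch d (initVec d x)) := by
    ext k
    simp [toTorus, hy, modelMap, (Fin.castSucc_lt_last k).ne, Fin.castSucc_eq_zero_iff]
  rw [h]
  have h2 : 1 / 2 - cutGraph η Φ (repVec (stretch d (initVec d x))) =
      - cutDev η Φ (repVec (stretch d (initVec d x))) := by
    simp only [cutGraph, cutDev]
    ring
  rw [h2]
  funext i
  by_cases hi : i = Fin.last (d + 1)
  · subst hi
    simp only [toTorus, hy, modelMap, shearedProfile, PiLp.sub_apply, PiLp.smul_apply,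
      PiLp.single_apply, if_true, Pi.add_apply, Pi.single_eq_same, smul_eq_mul, mul_one,
      ← AddCircle.coe_add]
    congr 1
    ring
  · simp [toTorus, hy, modelMap, hi]

variable {θ δ r : ℝ} {ψ φ : ℝ → ℝ}

/-- The shear term depends on `x̃` only, so it leaves `∂ₙQ` and hence the critical set unchanged; on
the slabs it is all that remains of `Q`. -/
lemma isModel_shearedProfile (hr : IsAdmissibleRadius d r) (hθ : 0 < θ) (hθr : θ < r / 2)
    (hψ : IsPsi θ ψ) (hδ : 0 < δ) (hδθ : δ < 2 * θ) (hφ : IsPhi δ φ) {q : Vec (d + 1) → ℝ}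
    {K : ℝ} (hK : K < 1 / 2) (hqK : ∀ y : Vec (d + 1), ∀ k, K ≤ |y k| → q y = 0)
    (hq : ContDiff ℝ 2 q) (hqb : ∀ z, |q z| ≤ 1 / 200) (hqd : ∀ z, ‖fderiv ℝ q z‖ ≤ 1 / 200) :
    IsModel (shearedProfile φ ψ q) := by
  have hφ2 : ContDiff ℝ 2 φ := hφ.smooth.of_le two_le_infty
  have hψ2 : ContDiff ℝ 2 ψ := hψ.smooth.of_le two_le_infty
  have hφd : Differentiable ℝ φ := hφ2.differentiable two_ne_zero
  have hψd : Differentiable ℝ ψ := hψ2.differentiable two_ne_zero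
  have h25 : (2 / 5 : ℝ) < 1 / 2 := by norm_num
  have hP0 := profile_eq_zero hr hθr hδθ hδ hφ.eq_zero hψ.eq_zero
  have hP0' := profile_eq_zero hr hθr hδθ hδ (fun s hs => hφ.deriv_eq_zero hs) hψ.eq_zero
  have hPc : ContDiff ℝ 2 fun x : Vec (d + 2) => profile φ ψ (repVec x) :=
    contDiff_comp_repVec h25 hP0 (contDiff_profile hφ2 hψ2)
  have hqc : ContDiff ℝ 2 fun z => q (repVec z) := contDiff_comp_repVec hK hqK hq
  have hqLc : ContDiff ℝ 2 fun x : Vec (d + 2) => q (repVec (stretch d (initVec d x))) :=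
    hqc.comp ((stretch d).contDiff.comp (initVec d).contDiff)
  have hqL : ∀ x : Vec (d + 2), HasFDerivAt
      (fun x : Vec (d + 2) => q (repVec (stretch d (initVec d x))))
      ((fderiv ℝ q (repVec (stretch d (initVec d x)))).comp ((stretch d).comp (initVec d))) x := by
    intro x
    rw [← fderiv_comp_repVec hK hqK]
    exact (hqc.differentiable two_ne_zero _).hasFDerivAt.comp x
      ((stretch d).comp (initVec d)).hasFDerivAt
  have hpart : ∀ x : Vec (d + 2), fderiv ℝ (shearedProfile φ ψ q) x
      (EuclideanSpace.single (Fin.last (d + 1)) 1) = profile (deriv φ) ψ (repVec x) := by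
    intro x
    have h1 : HasFDerivAt (shearedProfile φ ψ q) _ x :=
      (hPc.differentiable two_ne_zero x).hasFDerivAt.add (hqL x)
    rw [h1.fderiv, fderiv_comp_repVec h25 hP0, _root_.add_apply, fderiv_profile_last hφd hψd]
    simp
  have hslab : ∀ (N : ℤ) (x : Vec (d + 2)), x 0 ∈ Icc (N + 2 / 5 : ℝ) (N + 3 / 5) →
      shearedProfile φ ψ q x = q (repVec (stretch d (initVec d x))) := by
    intro N x hx
    rw [shearedProfile, hP0 (repVec x) 0 ?_, zero_add]
    obtain ⟨a, ha⟩ := exists_rep_eq (x 0)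
    rw [repVec_apply, ha]
    -- Otherwise the integer `N + a` would lie strictly between `-1` and `0`.
    by_contra! hlt
    obtain ⟨h1, h2⟩ := abs_lt.1 hlt
    have h3 : (-1 : ℝ) < (N + a : ℤ) := by push_cast; linarith [hx.2]
    have h4 : ((N + a : ℤ) : ℝ) < 0 := by push_cast; linarith [hx.1]
    norm_cast at h3 h4
    omega
  refine ⟨hPc.add hqLc, fun x a => ?_, fun x => ?_, fun x hx => ?_, fun N x hx => ?_,
    fun N x y hx hy => ?_⟩
  · have h1 : stretch d (initVec d (x + intVec a)) = stretch d (initVec d x) +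
        intVec fun k => (if k = 0 then 8 else 2) * a k.castSucc := by
      ext k
      by_cases hk : k = 0 <;> simp [hk]
    rw [shearedProfile, h1, repVec_add_intVec, repVec_add_intVec, shearedProfile]
  -- Since `φ' ∈ [-3/4, 1]` and `ψ ∈ [0, 4]`, the value `2 - φ'ψ` lies in `[-2, 5]`.
  · rw [hpart]
    have h1 := hφ.deriv_mem_Icc (repVec x (Fin.last (d + 1)))
    have h2 := hψ.mem_Icc hθ (‖initVec d (repVec x)‖ ^ 2)
    rw [profile, abs_le]
    constructor <;> nlinarith [h1.1, h1.2, h2.1, h2.2]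
  · rw [funext hpart, fderiv_comp_repVec h25 hP0']
    rw [hpart] at hx
    exact profile_deriv_nondegenerate hθ (by linarith [hr.lt]) hψ hφ _ hx
  · rw [hslab N x hx]
    exact hqb _
  · rw [hslab N x hx, hslab N y hy]
    -- The inner stretch costs a factor 8, and `8/200 ≤ 1/20`.
    refine convex_univ.norm_image_sub_le_of_norm_hasFDerivWithin_le
      (fun z _ => (hqL z).hasFDerivWithinAt) (fun z _ => ?_) (mem_univ y) (mem_univ x)
    refine ContinuousLinearMap.opNorm_le_bound _ (by norm_num) fun v => ?_
    rw [ContinuousLinearMap.comp_apply, ContinuousLinearMap.comp_apply]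
    have h1 := (fderiv ℝ q (repVec (stretch d (initVec d z)))).le_of_opNorm_le (hqd _)
      (stretch d (initVec d v))
    have h2 := norm_stretch_le (initVec d v)
    have h3 := norm_initVec_le v
    linarith [norm_nonneg v]

end Assembly

end TorusEndo

end


open TorusEndo
theorem mainTheorem1 (d : ℕ) (r θ a M δ : ℝ) (ψ φ : ℝ → ℝ)
    (hr : IsAdmissibleRadius d r)
    (hθ : 0 < θ) (hθr : θ < r / 2) (hψ : IsPsi θ ψ)
    (ha : 0 < a) (ha' : a < 3 / 7)
    (hM : IsGreatest (Set.range fun x => |deriv ψ x|) M)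
    (hδ : 0 < δ) (hδθ : δ < 2 * θ) (hδM : 2 * M * r * δ * (1 + a) < a)
    (hφ : IsPhi δ φ) :
    ∃ ε₀ : ℝ, 0 < ε₀ ∧ ∀ ε : ℝ, 0 < ε → ε < ε₀ →
      ∀ F : Torus (d + 2) → Torus (d + 2), IsFlattening d φ ψ ε F →
        IsRobustlyTransitive 2 (F ∘ mapF d φ ψ) := by
  -- With `ε' < ε/50` this gives `(d + 3) ε' ≤ 1/200`, where `d + 3` is the factor `m + 2` of the
  -- gradient bound in dimension `m = d + 1`.
  refine ⟨1 / (4 * (d + 3)), by positivity, ?_⟩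
  rintro ε - hε _ ⟨U, V, χ, ε', W, b, l, η, hχ, hε', hε'ε, hWU, hflat, -, hb4, hbW, hl, hlb, hη,
    rfl⟩
  have hΦ : ContDiffOn ℝ 2 (imageGraph d φ ψ χ) W :=
    contDiffOn_imageGraph (hφ.smooth.of_le two_le_infty)
      (hψ.smooth.of_le two_le_infty)
      (hχ.smooth.of_le two_le_infty) hWU
  have hsmall : (d + 3) * ε' ≤ 1 / 200 := by
    have h1 : ε' ≤ 1 / (4 * (d + 3)) / 50 := by linarith
    calc (d + 3) * ε' ≤ (d + 3) * (1 / (4 * (d + 3)) / 50) := by gcongr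
      _ = 1 / 200 := by field_simp; norm_num
  refine (isModel_shearedProfile hr hθ hθr hψ hδ hδθ hφ (K := 2 * l) (by linarith)
    (fun y k hk => cutDev_eq_zero hη (hk.trans (abs_apply_le_norm y k)))
    (contDiff_cutDev hΦ hflat.isOpen hbW hl hlb hη) (fun z => ?_)
    fun z => ?_).isRobustlyTransitive (isLift_shearedProfile φ ψ η _)
  · refine (abs_cutDev_le hflat hε' hbW hlb hη z).trans ?_
    have : 0 ≤ (d : ℝ) * ε' := by positivity
    linarith
  · refine (norm_fderiv_cutDev_le hflat hΦ hε' hbW hb4 hl hlb hη z).trans ?_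
    push_cast
    linarith
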